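/- **Conventions.** Let $G\rightrightarrows M$ be a Lie groupoid with source $s$, target $t$; $gh$ is defined when $s(g)=t(h)$. A $G$-path of order $n$ from $x$ to $y$ is a sequence $\sigma=\sigma_ng_n\sigma_{n-1}\cdots g_1\sigma_0$ of continuous paths $\sigma_j:[0,1]\to M$ and arrows $g_j:\sigma_{j-1}(1)\to\sigma_j(0)$, with $\sigma_0(0)=x$, $\sigma_n(1)=y$; its concatenation with a $G$-path $\sigma'$ starting at $y$ is $\sigma*\sigma'=\sigma'\,1_y\,\sigma$. $G$-homotopy is the equivalence relation on $G$-paths with fixed endpoints generated by (i) $g_{j+1}\sigma_jg_j\sim g_{j+1}g_j$ if $\sigma_j$ is constant, $0<j<n$; (ii) $\sigma_jg_j\sigma_{j-1}\sim\sigma_j\cdot\sigma_{j-1}$ if $g_j$ is a unit, $1\le j\le n$; (iii) continuous deformations of $G$-paths of fixed order with fixed endpoints. $\Pi_1(G,x)$ is the group of $G$-homotopy classes of $G$-loops at $x$, with $[\sigma][\sigma']=[\sigma*\sigma']$. Assume that $G$ is $G$-connected: any two points of $M$ are joined by a $G$-path. A local system $\mathcal L$ of $R$-modules over $G$ ($R$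 a ring) assigns to $x\in M$ a left $R$-module $\mathcal L_x$ and to a $G$-path $\sigma$ from $x$ to $y$ an $R$-linear map $\sigma_\#:\mathcal L_y\to\mathcal L_x$, depending only on the $G$-homotopy class, with $(\text{constant path})_\#=\mathrm{id}$ and $(\sigma*\sigma')_\#=\sigma_\#\sigma'_\#$; all $\sigma_\#$ are then isomorphisms. Let $G^{(0)}=M$ and $G^{(n)}=\{(g_1,\dots,g_n): s(g_j)=t(g_{j+1})\}$, with face maps $d_0^1=s$, $d_1^1=t$ and, for $n\ge2$, $d^n_0$ and $d^n_n$ dropping $g_1$ and $g_n$ respectively, and $d^n_k$ replacing $g_k,g_{k+1}$ by $g_kg_{k+1}$ for $0<k<n$. Put $\lambda_n(g_1,\dots,g_n)=s(g_n)$, $\lambda_0=\mathrm{id}$. Let $a_0,\dots,a_q$ be the vertices of the standard simplex $\triangle_q$. $C_q(G^{(n)},\mathcal L)$ is the module of finite formal sums $\sum_i v_i\cdot\Sigma_i$ with $\Sigma_i:\triangle_q\to G^{(n)}$ continuous and $v_i\in\mathcal L_{\lambda_n(\Sigma_i(a_0))}$, with the boundary operators $$\partial(v\cdot\Sigma)=\sum_{k=0}^{n-1}(-1)^kv\cdot(d^n_k\circ\Sigma)+(-1)^n(g^\Sigma_n)_\#^{-1}(v)\cdot(d^n_n\circ\Sigma),\qquad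 \overline d(v\cdot\Sigma)=\sigma_\#(v)\cdot d_0\Sigma+\sum_{j=1}^q(-1)^jv\cdot d_j\Sigma,$$ where $\partial=0$ for $n=0$ and $\overline d=0$ for $q=0$, $g^\Sigma_n$ is the last arrow of $\Sigma(a_0)$, $\sigma(\tau)=\lambda_n(\Sigma((1-\tau)a_1+\tau a_0))$, and $d_j\Sigma$ is the $j$-th face of $\Sigma$. Let $p:E\to M$ be a universal covering over $G$: a covering space of $M$ with a right $G$-action along $p$ (so that $e\cdot g$ is defined for $p(e)=t(g)$ and $p(e\cdot g)=s(g)$) such that the action groupoid $E\rtimes G\rightrightarrows E$, with arrows $(e,g):e\cdot g\to e$, is $(E\rtimes G)$-connected and has trivial fundamental groups. Let $E^{(\bullet)}$ be the nerve of $E\rtimes G$, and let $C_q(E^{(n)},\mathbb Z)$ be the free abelian group on the continuous maps $\triangle_q\to E^{(n)}$, with $\partial=\sum_{k=0}^n(-1)^kd^n_k$ (zero for $n=0$) and $d=\sum_{j=0}^q(-1)^jd_j$ (zero for $q=0$). Let $\Gamma^G(E)$ be the group of $G$-equivariant automorphisms of $E$ over $M$; it acts on $C_q(E^{(n)},\mathbb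 Z)$ by composition. Fix $e_0\in E$, $x_0=p(e_0)$ and $\mathcal L_0=\mathcal L_{x_0}$. Then $\Gamma^G(E)$ acts on $\mathcal L_0$ from the right by $v\cdot f=(\sigma_\#)^{-1}(v)$, where $\sigma=p_*(\tilde\sigma)$ for any $(E\rtimes G)$-path $\tilde\sigma$ from $e_0$ to $f(e_0)$. Let $\mathcal L_0\otimes_{\Gamma^G(E)}C_q(E^{(n)},\mathbb Z)$ be the quotient of $\mathcal L_0\otimes_{\mathbb Z}C_q(E^{(n)},\mathbb Z)$ by the subgroup generated by all $v\cdot f\otimes c-v\otimes f\cdot c$, with the boundary operators induced by $\partial$ and $d$. The total complex of a double complex $C_{q,n}$ of this kind is $\tilde C_v=\bigoplus_{q+n=v}C_{q,n}$ with $\delta=(-1)^{q+n}\partial+(-1)^qd$ on $C_{q,n}$. **Proposition (Eilenberg $G$-isomorphism).** Both $\mathcal L_0\otimes_{\Gamma^G(E)}C_\bullet(E^{(\bullet)},\mathbb Z)$ and $C_\bullet(G^{(\bullet)},\mathcal L)$ are double complexes (both boundary operators square to zero, and they commute), and there is a chain isomorphism between them: $R$-linear isomorphisms $$\mathcal L_0\otimes_{\Gamma^G(E)}C_q(E^{(n)},\mathbb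 Z)\cong C_q(G^{(n)},\mathcal L)\qquad(q,n\ge0)$$ that commute with both boundary operators. In particular, the total homologies $H_v(\mathcal L_0\otimes_{\Gamma^G(E)}E,\mathbb Z)$ and $H_v^{\mathrm{tot}}(G,\mathcal L)$ are isomorphic for every $v\ge 0$. -/

import Mathlib

open scoped Manifold ContDiff TensorProduct DirectSum

universe uM uG uE uR uL

noncomputable section

/-! ## Topological and Lie groupoids -/

/-- A topological groupoid `G ⇉ M`. An arrow `g` goes from `s g` to `t g`; the product `mul g h`
(written `gh`) is defined when `s g = t h`, i.e. first `h`, then `g`. -/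
structure TopGroupoid (M : Type uM) (G : Type uG) [TopologicalSpace M] [TopologicalSpace G] where
  /-- source -/
  s : G → M
  /-- target -/
  t : G → M
  /-- units -/
  u : M → G
  /-- inversion -/
  inv : G → G
  /-- partial composition -/
  mul : ∀ g h : G, s g = t h → G
  continuous_s : Continuous s
  continuous_t : Continuous t
  continuous_u : Continuous u
  continuous_inv : Continuous inv
  continuous_mul : Continuous fun q : {q : G × G // s q.1 = t q.2} => mul q.1.1 q.1.2 q.2
  s_u : ∀ x, s (u x) = x
  t_u : ∀ x, t (u x) = x
  s_inv : ∀ g, s (inv g) = t g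
  t_inv : ∀ g, t (inv g) = s g
  s_mul : ∀ g h hgh, s (mul g h hgh) = s h
  t_mul : ∀ g h hgh, t (mul g h hgh) = t g
  mul_assoc : ∀ g h k (hgh : s g = t h) (hhk : s h = t k),
    mul (mul g h hgh) k ((s_mul g h hgh).trans hhk) =
      mul g (mul h k hhk) (hgh.trans (t_mul h k hhk).symm)
  u_mul : ∀ g, mul (u (t g)) g (s_u _) = g
  mul_u : ∀ g, mul g (u (s g)) (t_u _).symm = g
  inv_mul : ∀ g, mul (inv g) g (s_inv g) = u (s g)
  mul_inv : ∀ g, mul g (inv g) (t_inv g).symm = u (t g)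

namespace TopGroupoid

variable {M : Type uM} {G : Type uG} [TopologicalSpace M] [TopologicalSpace G]

open Classical in
/-- A topological groupoid whose spaces of objects and arrows are smooth manifolds is a *Lie
groupoid* if source and target are smooth submersions and all structure maps are smooth.
Smoothness of the multiplication is smoothness on the closed submanifold of composable pairs of
`G × G`; the values off this set are irrelevant. -/
structure IsLie (m k : ℕ) [ChartedSpace (EuclideanSpace ℝ (Fin m)) M]
    [ChartedSpace (EuclideanSpace ℝ (Fin k)) G] (𝒢 : TopGroupoid M G) : Prop where
  submersion_s : Manifold.IsSubmersion (𝓡 k) (𝓡 m) ∞ 𝒢.s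
  submersion_t : Manifold.IsSubmersion (𝓡 k) (𝓡 m) ∞ 𝒢.t
  smooth_u : ContMDiff (𝓡 m) (𝓡 k) ∞ 𝒢.u
  smooth_inv : ContMDiff (𝓡 k) (𝓡 k) ∞ 𝒢.inv
  smooth_mul : ContMDiffOn ((𝓡 k).prod (𝓡 k)) (𝓡 k) ∞
    (fun q : G × G => if h : 𝒢.s q.1 = 𝒢.t q.2 then 𝒢.mul q.1 q.2 h else q.1)
    {q | 𝒢.s q.1 = 𝒢.t q.2}

/-- Morphisms of topological groupoids (continuous functors). -/
structure Hom {M' : Type*} {G' : Type*} [TopologicalSpace M'] [TopologicalSpace G']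
    (𝒢 : TopGroupoid M G) (𝒢' : TopGroupoid M' G') where
  obj : M → M'
  arr : G → G'
  continuous_obj : Continuous obj
  continuous_arr : Continuous arr
  s_arr : ∀ g, 𝒢'.s (arr g) = obj (𝒢.s g)
  t_arr : ∀ g, 𝒢'.t (arr g) = obj (𝒢.t g)
  arr_u : ∀ x, arr (𝒢.u x) = 𝒢'.u (obj x)
  arr_mul : ∀ g h (hgh : 𝒢.s g = 𝒢.t h), arr (𝒢.mul g h hgh) =
    𝒢'.mul (arr g) (arr h) (by rw [s_arr, t_arr, hgh])

/-! ## `G`-paths and `G`-homotopy -/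

/-- `G`-paths `σₙ gₙ σₙ₋₁ ⋯ σ₁ g₁ σ₀` from `x` to `y`, with `gⱼ : σⱼ₋₁(1) → σⱼ(0)`:
either a continuous path `σ₀`, or a `G`-path `τ` extended by an arrow `g` and a path `σ`, `σ g τ`. -/
inductive GPath (𝒢 : TopGroupoid M G) (x : M) : M → Type (max uM uG)
  | ofPath {y : M} (σ : Path x y) : GPath 𝒢 x y
  | snoc {y y' z : M} (τ : GPath 𝒢 x y) (g : G) (hs : 𝒢.s g = y) (ht : 𝒢.t g = y')
      (σ : Path y' z) : GPath 𝒢 x z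

variable {𝒢 : TopGroupoid M G}

namespace GPath

/-- The constant `G`-path (of order `0`). -/
def const (𝒢 : TopGroupoid M G) (x : M) : GPath 𝒢 x x := ofPath (Path.refl x)

/-- An arrow `g` viewed as the `G`-path `c g c` from `s g` to `t g`. -/
def arrow (g : G) : GPath 𝒢 (𝒢.s g) (𝒢.t g) :=
  snoc (const 𝒢 _) g rfl rfl (Path.refl _)

/-- Concatenation `σ * σ' = σ' 1 σ`: first `σ`, then `σ'`. -/
def concat {x y z : M} (σ : GPath 𝒢 x y) : GPath 𝒢 y z → GPath 𝒢 x z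
  | ofPath ρ => snoc σ (𝒢.u y) (𝒢.s_u y) (𝒢.t_u y) ρ
  | snoc τ g hs ht ρ => snoc (concat σ τ) g hs ht ρ

/-- A `G`-path from `x` to `y` as a `G`-path from `x` to `y'`, for `y = y'`. -/
def castEnd {x y y' : M} (h : y = y') (σ : GPath 𝒢 x y) : GPath 𝒢 x y' := h ▸ σ

/-- The image of a `G`-path under a groupoid morphism. -/
def map {M' : Type*} {G' : Type*} [TopologicalSpace M'] [TopologicalSpace G']
    {𝒢' : TopGroupoid M' G'} (φ : Hom 𝒢 𝒢') {x y : M} :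
    GPath 𝒢 x y → GPath 𝒢' (φ.obj x) (φ.obj y)
  | ofPath σ => ofPath (σ.map φ.continuous_obj)
  | snoc τ g hs ht σ => snoc (map φ τ) (φ.arr g) (by rw [φ.s_arr, hs]) (by rw [φ.t_arr, ht])
      (σ.map φ.continuous_obj)

/-- `Deforms σ σ' γ`: there is a continuous family of `G`-paths of a fixed order from `σ` to `σ'`,
with fixed initial point `x` and whose terminal point moves along `γ`. It consists of homotopies
`D₀, …, Dₙ` (first variable: the parameter of the deformation) and of paths `d₁, …, dₙ` of arrows
with `s ∘ dⱼ = Dⱼ₋₁(·, 1)` and `t ∘ dⱼ = Dⱼ(·, 0)`. -/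
inductive Deforms {x : M} : ∀ {y y' : M}, GPath 𝒢 x y → GPath 𝒢 x y' → Path y y' → Prop
  | ofPath {y y' : M} (σ : Path x y) (σ' : Path x y') (γ : Path y y') (D : C(unitInterval × unitInterval, M))
      (h0 : ∀ r, D (0, r) = σ r) (h1 : ∀ r, D (1, r) = σ' r)
      (hs : ∀ τ, D (τ, 0) = x) (ht : ∀ τ, D (τ, 1) = γ τ) :
      Deforms (GPath.ofPath σ) (GPath.ofPath σ') γ
  | snoc {y y' w w' z z' : M} {ρ : GPath 𝒢 x y} {ρ' : GPath 𝒢 x y'} {γ : Path y y'}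
      (h : Deforms ρ ρ' γ) {g g' : G} (d : Path g g')
      (hs : 𝒢.s g = y) (ht : 𝒢.t g = w) (hs' : 𝒢.s g' = y') (ht' : 𝒢.t g' = w')
      (hd : ∀ τ, 𝒢.s (d τ) = γ τ)
      (σ : Path w z) (σ' : Path w' z') (δ : Path z z') (D : C(unitInterval × unitInterval, M))
      (h0 : ∀ r, D (0, r) = σ r) (h1 : ∀ r, D (1, r) = σ' r)
      (hDs : ∀ τ, D (τ, 0) = 𝒢.t (d τ)) (hDt : ∀ τ, D (τ, 1) = δ τ) :
      Deforms (GPath.snoc ρ g hs ht σ) (GPath.snoc ρ' g' hs' ht' σ') δ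

/-- The elementary moves between `G`-paths with the same endpoints: multiplication equivalence,
concatenation equivalence (both applied anywhere inside a `G`-path), and deformations. -/
inductive Step {x : M} : ∀ {y : M}, GPath 𝒢 x y → GPath 𝒢 x y → Prop
  /-- `σ h c g τ ∼ σ (hg) τ` for a constant path `c` -/
  | mul {y y' z w : M} (τ : GPath 𝒢 x y) (g h : G) (hg : 𝒢.s g = y) (hg' : 𝒢.t g = y')
      (hh : 𝒢.s h = y') (hh' : 𝒢.t h = z) (σ : Path z w) :
      Step (snoc (snoc τ g hg hg' (Path.refl y')) h hh hh' σ)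
        (snoc τ (𝒢.mul h g (hh.trans hg'.symm)) ((𝒢.s_mul _ _ _).trans hg)
          ((𝒢.t_mul _ _ _).trans hh') σ)
  /-- `σ' 1 σ ∼ σ'·σ` -/
  | concat_ofPath {y z : M} (σ : Path x y) (σ' : Path y z) :
      Step (snoc (ofPath σ) (𝒢.u y) (𝒢.s_u y) (𝒢.t_u y) σ') (ofPath (σ.trans σ'))
  /-- `σ' 1 σ g τ ∼ (σ'·σ) g τ` -/
  | concat_snoc {y y' z w : M} (τ : GPath 𝒢 x y) (g : G) (hg : 𝒢.s g = y) (hg' : 𝒢.t g = y')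
      (σ : Path y' z) (σ' : Path z w) :
      Step (snoc (snoc τ g hg hg' σ) (𝒢.u z) (𝒢.s_u z) (𝒢.t_u z) σ')
        (snoc τ g hg hg' (σ.trans σ'))
  /-- the moves may be applied to an initial piece of a `G`-path -/
  | snoc_congr {y y' z : M} {τ τ' : GPath 𝒢 x y} (h : Step τ τ') (g : G) (hg : 𝒢.s g = y)
      (hg' : 𝒢.t g = y') (σ : Path y' z) : Step (snoc τ g hg hg' σ) (snoc τ' g hg hg' σ)
  | deform {y : M} {σ σ' : GPath 𝒢 x y} (h : Deforms σ σ' (Path.refl y)) : Step σ σ'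

/-- `G`-homotopy: the equivalence relation generated by the elementary moves. -/
def Homotopic {x y : M} (σ σ' : GPath 𝒢 x y) : Prop := Relation.EqvGen Step σ σ'

end GPath

/-- `G`-homotopy classes of `G`-paths from `x` to `y`. -/
def HomotopyClass (𝒢 : TopGroupoid M G) (x y : M) : Type _ :=
  Quot (GPath.Homotopic (𝒢 := 𝒢) (x := x) (y := y))

/-- The (underlying set of the) fundamental group `Π₁(G, x)`. -/
abbrev FundamentalGroup (𝒢 : TopGroupoid M G) (x : M) : Type _ := HomotopyClass 𝒢 x x

/-- `G`-connectedness. -/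
def IsConnected (𝒢 : TopGroupoid M G) : Prop := ∀ x y : M, Nonempty (GPath 𝒢 x y)

/-- `G` is simply connected: connected, with trivial fundamental groups. -/
def IsSimplyConnected (𝒢 : TopGroupoid M G) : Prop :=
  𝒢.IsConnected ∧ ∀ x : M, Subsingleton (𝒢.FundamentalGroup x)

/-! ## The nerve -/

/-- The space `G⁽ⁿ⁾` of strings `(g₁, …, gₙ)` with `s gⱼ = t gⱼ₊₁`. The vertices
`x₀ = t g₁, …, xⱼ = s gⱼ, …, xₙ = s gₙ` of the string are recorded as well: they are redundant for
`1 ≤ n` and give `G⁽⁰⁾ = M`. (In the code arrows are numbered from `0`.) -/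
def Nerve (𝒢 : TopGroupoid M G) (n : ℕ) : Type _ :=
  {a : (Fin (n + 1) → M) × (Fin n → G) //
    ∀ j : Fin n, 𝒢.t (a.2 j) = a.1 j.castSucc ∧ 𝒢.s (a.2 j) = a.1 j.succ}

namespace Nerve

instance (n : ℕ) : TopologicalSpace (𝒢.Nerve n) :=
  inferInstanceAs (TopologicalSpace {a : (Fin (n + 1) → M) × (Fin n → G) //
    ∀ j : Fin n, 𝒢.t (a.2 j) = a.1 j.castSucc ∧ 𝒢.s (a.2 j) = a.1 j.succ})

/-- The `j`-th vertex. -/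
def vertex {n : ℕ} (a : 𝒢.Nerve n) (j : Fin (n + 1)) : M := a.1.1 j

/-- The `j`-th arrow. -/
def arrow {n : ℕ} (a : 𝒢.Nerve n) (j : Fin n) : G := a.1.2 j

lemma t_arrow {n : ℕ} (a : 𝒢.Nerve n) (j : Fin n) : 𝒢.t (a.arrow j) = a.vertex j.castSucc :=
  (a.2 j).1

lemma s_arrow {n : ℕ} (a : 𝒢.Nerve n) (j : Fin n) : 𝒢.s (a.arrow j) = a.vertex j.succ :=
  (a.2 j).2

/-- The last vertex `λₙ(g₁, …, gₙ) = s gₙ`, with `λ₀ = id`. -/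
def last {n : ℕ} (a : 𝒢.Nerve n) : M := a.vertex (Fin.last n)

lemma continuous_vertex {n : ℕ} (j : Fin (n + 1)) :
    Continuous fun a : 𝒢.Nerve n => a.vertex j :=
  (continuous_apply j).comp (continuous_fst.comp continuous_subtype_val)

lemma continuous_arrow {n : ℕ} (j : Fin n) : Continuous fun a : 𝒢.Nerve n => a.arrow j :=
  (continuous_apply j).comp (continuous_snd.comp continuous_subtype_val)

lemma continuous_last {n : ℕ} : Continuous fun a : 𝒢.Nerve n => a.last :=
  continuous_vertex _

/-- Consecutive arrows are composable. -/
lemma composable {n : ℕ} (a : 𝒢.Nerve (n + 1)) (j : Fin n) :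
    𝒢.s (a.arrow j.castSucc) = 𝒢.t (a.arrow j.succ) := by
  rw [a.s_arrow, a.t_arrow]; rfl

/-- The `j`-th arrow of the `k`-th face: arrows before the vertex `k` are kept, the two arrows
meeting in the vertex `k` are composed, arrows behind it are shifted. For `k = 0` or `k = n + 1`
no composition occurs, and the first, respectively the last, arrow is dropped. -/
def faceArrow {n : ℕ} (k : Fin (n + 2)) (a : 𝒢.Nerve (n + 1)) (j : Fin n) : G :=
  if (j : ℕ) + 1 < k then a.arrow j.castSucc
  else if (j : ℕ) + 1 = k then 𝒢.mul (a.arrow j.castSucc) (a.arrow j.succ) (a.composable j)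
  else a.arrow j.succ

lemma continuous_faceArrow {n : ℕ} (k : Fin (n + 2)) (j : Fin n) :
    Continuous fun a : 𝒢.Nerve (n + 1) => faceArrow k a j := by
  unfold faceArrow
  split_ifs
  · exact continuous_arrow _
  · exact 𝒢.continuous_mul.comp (Continuous.subtype_mk
      ((continuous_arrow j.castSucc).prodMk (continuous_arrow j.succ)) fun a => a.composable j)
  · exact continuous_arrow _

lemma faceArrow_spec {n : ℕ} (k : Fin (n + 2)) (a : 𝒢.Nerve (n + 1)) (j : Fin n) :
    𝒢.t (faceArrow k a j) = a.vertex (k.succAbove j.castSucc) ∧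
      𝒢.s (faceArrow k a j) = a.vertex (k.succAbove j.succ) := by
  unfold faceArrow
  split_ifs with h1 h2
  · rw [a.t_arrow, a.s_arrow, Fin.succAbove_of_castSucc_lt, Fin.succAbove_of_castSucc_lt]
    · exact ⟨rfl, rfl⟩
    · rw [Fin.lt_def]; simpa using h1
    · rw [Fin.lt_def]; simp; omega
  · rw [𝒢.t_mul, 𝒢.s_mul, a.t_arrow, a.s_arrow, Fin.succAbove_of_castSucc_lt,
      Fin.succAbove_of_le_castSucc]
    · exact ⟨rfl, rfl⟩
    · rw [Fin.le_def]; simp; omega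
    · rw [Fin.lt_def]; simp; omega
  · rw [a.t_arrow, a.s_arrow, Fin.succAbove_of_le_castSucc, Fin.succAbove_of_le_castSucc]
    · exact ⟨rfl, rfl⟩
    · rw [Fin.le_def]; simp; omega
    · rw [Fin.le_def]; simp; omega

/-- The `k`-th face map `d_k : G⁽ⁿ⁺¹⁾ → G⁽ⁿ⁾`, which omits the `k`-th vertex:
`(g₂, …)` for `k = 0`, `(…, g_k g_{k+1}, …)` for `0 < k < n + 1`, `(g₁, …, gₙ)` for `k = n + 1`. -/
def face {n : ℕ} (k : Fin (n + 2)) : C(𝒢.Nerve (n + 1), 𝒢.Nerve n) where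
  toFun a := ⟨(fun j => a.vertex (k.succAbove j), faceArrow k a), faceArrow_spec k a⟩
  continuous_toFun := Continuous.subtype_mk
    ((continuous_pi fun _ => continuous_vertex _).prodMk
      (continuous_pi fun j => continuous_faceArrow k j)) _

/-- The map induced by a groupoid morphism along the nerves. -/
def map {M' : Type*} {G' : Type*} [TopologicalSpace M'] [TopologicalSpace G']
    {𝒢' : TopGroupoid M' G'} (φ : Hom 𝒢 𝒢') (n : ℕ) : C(𝒢.Nerve n, 𝒢'.Nerve n) where
  toFun a := ⟨(fun j => φ.obj (a.vertex j), fun j => φ.arr (a.arrow j)), fun j => by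
    simp only [φ.t_arr, φ.s_arr, a.t_arrow, a.s_arrow, and_self]⟩
  continuous_toFun := Continuous.subtype_mk
    ((continuous_pi fun j => φ.continuous_obj.comp (continuous_vertex j)).prodMk
      (continuous_pi fun j => φ.continuous_arr.comp (continuous_arrow j))) _

lemma map_face {M' : Type*} {G' : Type*} [TopologicalSpace M'] [TopologicalSpace G']
    {𝒢' : TopGroupoid M' G'} (φ : Hom 𝒢 𝒢') {n : ℕ} (k : Fin (n + 2)) (a : 𝒢.Nerve (n + 1)) :
    map φ n (face k a) = face k (map φ (n + 1) a) := by
  apply Subtype.ext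
  refine Prod.ext rfl (funext fun j => ?_)
  change φ.arr (faceArrow k a j) = faceArrow k (map φ (n + 1) a) j
  unfold faceArrow
  split_ifs
  · rfl
  · exact φ.arr_mul _ _ _
  · rfl

lemma last_face {n : ℕ} (k : Fin (n + 1)) (a : 𝒢.Nerve (n + 1)) :
    (face k.castSucc a).last = a.last := by
  change a.vertex (k.castSucc.succAbove (Fin.last n)) = a.vertex (Fin.last (n + 1))
  rw [Fin.succAbove_of_le_castSucc _ _ (by rw [Fin.castSucc_le_castSucc_iff]; exact Fin.le_last k)]
  rfl

lemma last_face_last {n : ℕ} (a : 𝒢.Nerve (n + 1)) :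
    (face (Fin.last (n + 1)) a).last = 𝒢.t (a.arrow (Fin.last n)) := by
  rw [a.t_arrow]
  change a.vertex ((Fin.last (n + 1)).succAbove (Fin.last n)) = _
  rw [Fin.succAbove_last]

lemma last_eq_s {n : ℕ} (a : 𝒢.Nerve (n + 1)) : 𝒢.s (a.arrow (Fin.last n)) = a.last :=
  a.s_arrow _

end Nerve

/-! ## Singular simplices of the nerve -/

/-- The standard simplex `△_q`. -/
abbrev Delta (q : ℕ) : Type := stdSimplex ℝ (Fin (q + 1))

/-- The vertex `a_i` of `△_q`. -/
abbrev dvertex {q : ℕ} (i : Fin (q + 1)) : Delta q := stdSimplex.vertex i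

/-- The inclusion `△_q → △_{q+1}` of the face opposite to `a_j`. -/
def dface {q : ℕ} (j : Fin (q + 2)) : C(Delta q, Delta (q + 1)) where
  toFun := stdSimplex.map j.succAbove
  continuous_toFun := stdSimplex.continuous_map _

/-- The segment `τ ↦ (1 - τ) a₁ + τ a₀` from `a₁` to `a₀`. -/
def dedge (q : ℕ) : Path (dvertex (q := q + 1) 1) (dvertex (q := q + 1) 0) where
  toFun τ := ⟨(1 - (τ : ℝ)) • (dvertex (q := q + 1) 1).1 + (τ : ℝ) • (dvertex (q := q + 1) 0).1,
    convex_stdSimplex ℝ _ (dvertex (q := q + 1) 1).2 (dvertex (q := q + 1) 0).2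
      (sub_nonneg.2 τ.2.2) τ.2.1 (by ring)⟩
  continuous_toFun := by fun_prop
  source' := by apply Subtype.ext; simp
  target' := by apply Subtype.ext; simp

/-- `n`-singular `q`-simplices `△_q → G⁽ⁿ⁾`. -/
abbrev Simplex (𝒢 : TopGroupoid M G) (q n : ℕ) : Type _ := C(Delta q, 𝒢.Nerve n)

namespace Simplex

/-- The `j`-th singular face `d_j Σ`. -/
def sface {q n : ℕ} (j : Fin (q + 2)) (S : 𝒢.Simplex (q + 1) n) : 𝒢.Simplex q n :=
  S.comp (dface j)

/-- The `k`-th nerve face `d_k ∘ Σ`. -/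
def nface {q n : ℕ} (k : Fin (n + 2)) (S : 𝒢.Simplex q (n + 1)) : 𝒢.Simplex q n :=
  (Nerve.face k).comp S

/-- The image of a simplex under a groupoid morphism. -/
def map {M' : Type*} {G' : Type*} [TopologicalSpace M'] [TopologicalSpace G']
    {𝒢' : TopGroupoid M' G'} (φ : Hom 𝒢 𝒢') {q n : ℕ} (S : 𝒢.Simplex q n) : 𝒢'.Simplex q n :=
  (Nerve.map φ n).comp S

/-- The point `λₙ(Σ(a₀))`. -/
def base {q n : ℕ} (S : 𝒢.Simplex q n) : M := (S (dvertex 0)).last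

/-- The arrow `gₙ^Σ`: the last arrow of `Σ(a₀)`. -/
def lastArrow {q n : ℕ} (S : 𝒢.Simplex q (n + 1)) : G := (S (dvertex 0)).arrow (Fin.last n)

/-- The path `τ ↦ λₙ(Σ((1 - τ) a₁ + τ a₀))` in `M`. -/
def edge {q n : ℕ} (S : 𝒢.Simplex (q + 1) n) : Path (S (dvertex 1)).last S.base :=
  (dedge q).map (f := fun z => (S z).last) (Nerve.continuous_last.comp S.continuous)

lemma sface_dvertex {q n : ℕ} (j : Fin (q + 2)) (S : 𝒢.Simplex (q + 1) n) (i : Fin (q + 1)) :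
    sface j S (dvertex i) = S (dvertex (j.succAbove i)) := by
  change S (stdSimplex.map j.succAbove (stdSimplex.vertex i)) = _
  rw [stdSimplex.map_vertex]

lemma base_sface_succ {q n : ℕ} (j : Fin (q + 1)) (S : 𝒢.Simplex (q + 1) n) :
    base (sface j.succ S) = base S := by
  unfold base
  rw [sface_dvertex, Fin.succ_succAbove_zero]

lemma base_sface_zero {q n : ℕ} (S : 𝒢.Simplex (q + 1) n) :
    base (sface 0 S) = (S (dvertex 1)).last := by
  unfold base
  rw [sface_dvertex]; rfl

lemma base_nface_castSucc {q n : ℕ} (k : Fin (n + 1)) (S : 𝒢.Simplex q (n + 1)) :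
    base (nface k.castSucc S) = base S :=
  Nerve.last_face k _

lemma base_nface_last {q n : ℕ} (S : 𝒢.Simplex q (n + 1)) :
    base (nface (Fin.last (n + 1)) S) = 𝒢.t (lastArrow S) :=
  Nerve.last_face_last _

lemma s_lastArrow {q n : ℕ} (S : 𝒢.Simplex q (n + 1)) : 𝒢.s (lastArrow S) = base S :=
  Nerve.last_eq_s _

end Simplex

/-! ## Local systems -/

/-- A local system of `R`-modules over `G`. -/
structure LocalSystem (R : Type uR) [Ring R] (𝒢 : TopGroupoid M G) where
  /-- the fibres `𝓛_x` -/
  fib : M → Type uL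
  [addCommGroup : ∀ x, AddCommGroup (fib x)]
  [module : ∀ x, Module R (fib x)]
  /-- `σ_# : 𝓛_y → 𝓛_x` for a `G`-path `σ` from `x` to `y` -/
  tr : ∀ {x y : M}, GPath 𝒢 x y → fib y →ₗ[R] fib x
  tr_homotopic : ∀ {x y : M} (σ σ' : GPath 𝒢 x y), σ.Homotopic σ' → tr σ = tr σ'
  tr_const : ∀ x : M, tr (GPath.const 𝒢 x) = LinearMap.id
  tr_concat : ∀ {x y z : M} (σ : GPath 𝒢 x y) (σ' : GPath 𝒢 y z),
    tr (σ.concat σ') = tr σ ∘ₗ tr σ'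

namespace GPath

lemma snoc_eq {x y y' z : M} (τ : GPath 𝒢 x y) {g g' : G} (h : g = g') (hs : 𝒢.s g = y)
    (ht : 𝒢.t g = y') (σ : Path y' z) :
    snoc τ g hs ht σ = snoc τ g' (h ▸ hs) (h ▸ ht) σ := by
  subst h; rfl

lemma Homotopic.of_step {x y : M} {σ σ' : GPath 𝒢 x y} (h : Step σ σ') : σ.Homotopic σ' :=
  Relation.EqvGen.rel _ _ h

lemma Homotopic.trans {x y : M} {σ σ' σ'' : GPath 𝒢 x y} (h : σ.Homotopic σ')
    (h' : σ'.Homotopic σ'') : σ.Homotopic σ'' :=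
  Relation.EqvGen.trans _ _ _ h h'

lemma Deforms.rfl {x y : M} (σ : GPath 𝒢 x y) : Deforms σ σ (Path.refl y) := by
  induction σ with
  | ofPath σ =>
    exact Deforms.ofPath σ σ _ ⟨fun p => σ p.2, by fun_prop⟩ (fun _ => by rfl) (fun _ => by rfl)
      (fun _ => by simp) (fun _ => by simp)
  | snoc τ g hs ht σ ih =>
    exact Deforms.snoc ih (Path.refl g) hs ht hs ht (fun _ => by simpa using hs) σ σ _
      ⟨fun p => σ p.2, by fun_prop⟩ (fun _ => by rfl) (fun _ => by rfl)
      (fun _ => by simpa using ht.symm) (fun _ => by simp)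

/-- Homotopic paths give homotopic `G`-paths. -/
lemma homotopic_ofPath {x y : M} {σ σ' : Path x y} (F : Path.Homotopy σ σ') :
    Homotopic (𝒢 := 𝒢) (ofPath σ) (ofPath σ') :=
  .of_step <| .deform <| .ofPath σ σ' _ F.toContinuousMap (fun r => F.apply_zero r)
    (fun r => F.apply_one r) (fun τ => F.source τ) (fun τ => F.target τ)

lemma homotopic_snoc {x y y' z : M} (τ : GPath 𝒢 x y) (g : G) (hs : 𝒢.s g = y)
    (ht : 𝒢.t g = y') {σ σ' : Path y' z} (F : Path.Homotopy σ σ') :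
    Homotopic (snoc τ g hs ht σ) (snoc τ g hs ht σ') :=
  .of_step <| .deform <| .snoc (.rfl τ) (Path.refl g) hs ht hs ht (fun _ => by simpa using hs)
    σ σ' _ F.toContinuousMap (fun r => F.apply_zero r) (fun r => F.apply_one r)
    (fun τ => (F.source τ).trans (by simpa using ht.symm)) (fun τ => F.target τ)

/-- A `G`-path is the concatenation of its pieces. -/
lemma concat_arrow_homotopic {x z : M} (g : G) (τ : GPath 𝒢 x (𝒢.s g)) (σ : Path (𝒢.t g) z) :
    Homotopic ((τ.concat (arrow g)).concat (ofPath σ)) (snoc τ g rfl rfl σ) := by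
  refine (Homotopic.of_step (Step.concat_snoc _ g rfl rfl (Path.refl _) σ)).trans ?_
  refine (Homotopic.of_step (Step.mul τ _ g (𝒢.s_u _) (𝒢.t_u _) rfl rfl _)).trans ?_
  rw [snoc_eq τ (𝒢.mul_u g)]
  exact homotopic_snoc _ _ _ _ (Path.Homotopy.reflTrans σ)

lemma ofPath_symm_homotopic {x y : M} (σ : Path x y) :
    Homotopic (𝒢 := 𝒢) ((ofPath σ).concat (ofPath σ.symm)) (const 𝒢 x) :=
  (Homotopic.of_step (Step.concat_ofPath σ σ.symm)).trans
    (homotopic_ofPath (Path.Homotopy.reflTransSymm σ).symm)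

lemma arrow_inv_homotopic (g : G) {x y : M} (hx : 𝒢.s g = x) (hy : 𝒢.t g = y) :
    Homotopic ((snoc (const 𝒢 x) g hx hy (Path.refl y)).concat
      (snoc (const 𝒢 y) (𝒢.inv g) ((𝒢.s_inv g).trans hy) ((𝒢.t_inv g).trans hx) (Path.refl x)))
      (const 𝒢 x) := by
  subst hx hy
  refine (Homotopic.of_step (Step.mul _ _ _ (𝒢.s_u _) (𝒢.t_u _) _ _ _)).trans ?_
  have h1 : 𝒢.mul (𝒢.inv g) (𝒢.u (𝒢.t g)) ((𝒢.s_inv g).trans (𝒢.t_u _).symm) = 𝒢.inv g := by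
    have h := 𝒢.mul_u (𝒢.inv g)
    simpa only [𝒢.s_inv] using h
  rw [snoc_eq _ h1]
  refine (Homotopic.of_step (Step.mul _ _ _ _ _ _ _ _)).trans ?_
  rw [snoc_eq _ (𝒢.inv_mul g)]
  refine (Homotopic.of_step (Step.concat_ofPath _ _)).trans ?_
  rw [Path.refl_trans_refl]
  exact Relation.EqvGen.refl _

lemma map_concat {M' : Type*} {G' : Type*} [TopologicalSpace M'] [TopologicalSpace G']
    {𝒢' : TopGroupoid M' G'} (φ : Hom 𝒢 𝒢') {x y z : M} (σ : GPath 𝒢 x y) (τ : GPath 𝒢 y z) :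
    (σ.concat τ).map φ = (σ.map φ).concat (τ.map φ) := by
  induction τ with
  | ofPath ρ => exact snoc_eq _ (φ.arr_u _) _ _ _
  | snoc τ g hs ht ρ ih => simp only [concat, map, ih]

lemma Deforms.map {M' : Type*} {G' : Type*} [TopologicalSpace M'] [TopologicalSpace G']
    {𝒢' : TopGroupoid M' G'} (φ : Hom 𝒢 𝒢') {x y y' : M} {σ : GPath 𝒢 x y} {σ' : GPath 𝒢 x y'}
    {γ : Path y y'} (h : Deforms σ σ' γ) :
    Deforms (σ.map φ) (σ'.map φ) (γ.map φ.continuous_obj) := by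
  induction h with
  | ofPath σ σ' γ D h0 h1 hs ht =>
    exact Deforms.ofPath _ _ _ ⟨fun p => φ.obj (D p), φ.continuous_obj.comp D.continuous⟩
      (fun r => by simp [h0]) (fun r => by simp [h1]) (fun r => by simp [hs])
      (fun r => by simp [ht])
  | snoc h d hs ht hs' ht' hd σ σ' δ D h0 h1 hDs hDt ih =>
    exact Deforms.snoc ih (d.map φ.continuous_arr) _ _ _ _ (fun r => by simp [φ.s_arr, hd]) _ _ _
      ⟨fun p => φ.obj (D p), φ.continuous_obj.comp D.continuous⟩
      (fun r => by simp [h0]) (fun r => by simp [h1]) (fun r => by simp [hDs, φ.t_arr])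
      (fun r => by simp [hDt])

lemma path_map_refl {X Y : Type*} [TopologicalSpace X] [TopologicalSpace Y] {f : X → Y}
    (hf : Continuous f) (x : X) : (Path.refl x).map hf = Path.refl (f x) := rfl

lemma Step.map {M' : Type*} {G' : Type*} [TopologicalSpace M'] [TopologicalSpace G']
    {𝒢' : TopGroupoid M' G'} (φ : Hom 𝒢 𝒢') {x y : M} {σ σ' : GPath 𝒢 x y} (h : Step σ σ') :
    Step (σ.map φ) (σ'.map φ) := by
  induction h with
  | mul τ g h hg hg' hh hh' σ =>
    simp only [GPath.map, path_map_refl]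
    rw [snoc_eq (τ.map φ) (φ.arr_mul _ _ _)]
    exact Step.mul _ _ _ _ _ _ _ _
  | concat_ofPath σ σ' =>
    simp only [GPath.map, Path.map_trans]
    rw [snoc_eq _ (φ.arr_u _)]
    exact Step.concat_ofPath _ _
  | concat_snoc τ g hg hg' σ σ' =>
    simp only [GPath.map, Path.map_trans]
    rw [snoc_eq _ (φ.arr_u _)]
    exact Step.concat_snoc _ _ _ _ _ _
  | snoc_congr h g hg hg' σ ih => exact Step.snoc_congr ih _ _ _ _
  | deform h =>
    have := h.map φ
    rw [path_map_refl] at this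
    exact Step.deform this

/-- Groupoid morphisms preserve `G`-homotopy. -/
lemma Homotopic.map {M' : Type*} {G' : Type*} [TopologicalSpace M'] [TopologicalSpace G']
    {𝒢' : TopGroupoid M' G'} (φ : Hom 𝒢 𝒢') {x y : M} {σ σ' : GPath 𝒢 x y}
    (h : σ.Homotopic σ') : (σ.map φ).Homotopic (σ'.map φ) := by
  induction h with
  | rel _ _ h => exact .of_step (h.map φ)
  | refl _ => exact .refl _
  | symm _ _ _ ih => exact ih.symm
  | trans _ _ _ _ _ ih ih' => exact ih.trans ih'

end GPath

namespace LocalSystem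

variable {R : Type uR} [Ring R]

instance (L : LocalSystem.{uM, uG, uR, uL} R 𝒢) (x : M) : AddCommGroup (L.fib x) :=
  L.addCommGroup x

instance (L : LocalSystem.{uM, uG, uR, uL} R 𝒢) (x : M) : Module R (L.fib x) := L.module x

variable (L : LocalSystem.{uM, uG, uR, uL} R 𝒢)

lemma tr_tr_of_homotopic {x y : M} {σ : GPath 𝒢 x y} {σ' : GPath 𝒢 y x}
    (h : (σ.concat σ').Homotopic (GPath.const 𝒢 x)) (v : L.fib x) : L.tr σ (L.tr σ' v) = v := by
  have := L.tr_homotopic _ _ h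
  rw [L.tr_concat, L.tr_const] at this
  exact LinearMap.congr_fun this v

/-- Every `σ_#` is an isomorphism. -/
lemma tr_bijective {x y : M} (σ : GPath 𝒢 x y) : Function.Bijective (L.tr σ) := by
  have hP : ∀ {x y : M} (σ : Path x y), Function.Bijective (L.tr (GPath.ofPath (𝒢 := 𝒢) σ)) := by
    intro x y σ
    refine Function.bijective_iff_has_inverse.2 ⟨L.tr (GPath.ofPath σ.symm), fun v => ?_, fun v =>
      L.tr_tr_of_homotopic (GPath.ofPath_symm_homotopic σ) v⟩
    have := GPath.ofPath_symm_homotopic (𝒢 := 𝒢) σ.symm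
    rw [Path.symm_symm] at this
    exact L.tr_tr_of_homotopic this v
  have hA : ∀ g : G, Function.Bijective (L.tr (GPath.arrow (𝒢 := 𝒢) g)) := by
    intro g
    refine Function.bijective_iff_has_inverse.2 ⟨L.tr (GPath.snoc (GPath.const 𝒢 _) (𝒢.inv g)
      (𝒢.s_inv g) (𝒢.t_inv g) (Path.refl _)), fun v => ?_, fun v =>
      L.tr_tr_of_homotopic (GPath.arrow_inv_homotopic g rfl rfl) v⟩
    have hinv : 𝒢.inv (𝒢.inv g) = g := by
      have h1 := 𝒢.mul_assoc (𝒢.inv (𝒢.inv g)) (𝒢.inv g) g (𝒢.s_inv _) (𝒢.s_inv g)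
      have h2 := 𝒢.u_mul g
      have h3 := 𝒢.mul_u (𝒢.inv (𝒢.inv g))
      simp only [𝒢.inv_mul, 𝒢.s_inv] at h1
      simp only [𝒢.s_inv, 𝒢.t_inv] at h3
      rw [← h3, ← h1]
      exact h2
    have := GPath.arrow_inv_homotopic (𝒢.inv g) (𝒢.s_inv g) (𝒢.t_inv g)
    rw [GPath.snoc_eq (GPath.const 𝒢 _) hinv] at this
    exact L.tr_tr_of_homotopic this v
  induction σ with
  | ofPath σ => exact hP σ
  | snoc τ g hs ht σ ih =>
    subst hs ht
    rw [← L.tr_homotopic _ _ (GPath.concat_arrow_homotopic g τ σ), L.tr_concat, L.tr_concat]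
    exact (ih.comp (hA g)).comp (hP σ)

/-- The isomorphism `σ_#`. -/
def trEquiv {x y : M} (σ : GPath 𝒢 x y) : L.fib y ≃ₗ[R] L.fib x :=
  LinearEquiv.ofBijective (L.tr σ) (L.tr_bijective σ)

/-- The identity `𝓛_x = 𝓛_y` for `x = y`. -/
def cast {x y : M} (h : x = y) : L.fib x ≃ₗ[R] L.fib y :=
  h ▸ LinearEquiv.refl R (L.fib x)

end LocalSystem

end TopGroupoid

/-! ## Double complexes -/

/-- The data of a double complex of `R`-modules: modules `C q n` with maps `∂` lowering `n` and
`d` lowering `q`. -/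
structure DoubleComplexData (R : Type uR) [Ring R] where
  C : ℕ → ℕ → Type uL
  [addCommGroup : ∀ q n, AddCommGroup (C q n)]
  [module : ∀ q n, Module R (C q n)]
  del : ∀ q n, C q (n + 1) →ₗ[R] C q n
  d : ∀ q n, C (q + 1) n →ₗ[R] C q n

namespace DoubleComplexData

variable {R : Type uR} [Ring R]

instance (A : DoubleComplexData.{uR, uL} R) (q n : ℕ) : AddCommGroup (A.C q n) :=
  A.addCommGroup q n

instance (A : DoubleComplexData.{uR, uL} R) (q n : ℕ) : Module R (A.C q n) := A.module q n

/-- The data form a double complex: `∂² = 0`, `d² = 0`, and `∂`, `d` commute. -/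
structure IsDoubleComplex (A : DoubleComplexData.{uR, uL} R) : Prop where
  del_del : ∀ q n, A.del q n ∘ₗ A.del q (n + 1) = 0
  d_d : ∀ q n, A.d q n ∘ₗ A.d (q + 1) n = 0
  comm : ∀ q n, A.d q n ∘ₗ A.del (q + 1) n = A.del q n ∘ₗ A.d q (n + 1)

/-- A chain isomorphism of double complexes: isomorphisms in every bidegree commuting with both
boundary operators. -/
structure Iso (A : DoubleComplexData.{uR, uL} R) (B : DoubleComplexData.{uR, uE} R) where
  equiv : ∀ q n, A.C q n ≃ₗ[R] B.C q n
  del_comm : ∀ q n (a : A.C q (n + 1)), equiv q n (A.del q n a) = B.del q n (equiv q (n + 1) a)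
  d_comm : ∀ q n (a : A.C (q + 1) n), equiv q n (A.d q n a) = B.d q n (equiv (q + 1) n a)

variable (A : DoubleComplexData.{uR, uL} R)

/-- `C̃_v = ⨁_{q + n = v} C_{q,n}`. -/
abbrev Tot (v : ℕ) : Type _ := ⨁ i : {i : ℕ × ℕ // i.1 + i.2 = v}, A.C i.1.1 i.1.2

open Classical in
/-- The inclusion of `C_{q,n}` in the total complex. -/
def incl {v : ℕ} (q n : ℕ) (h : q + n = v) : A.C q n →ₗ[R] A.Tot v :=
  DirectSum.lof R {i : ℕ × ℕ // i.1 + i.2 = v} (fun i => A.C i.1.1 i.1.2) ⟨(q, n), h⟩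

/-- The part `γ ↦ (-1)^{q+n} ∂γ` of the total differential (`0` for `n = 0`). -/
def totDel (v : ℕ) : ∀ q n, q + n = v + 1 → (A.C q n →ₗ[R] A.Tot v)
  | _, 0, _ => 0
  | q, n + 1, h => ((-1 : ℤ) ^ (q + (n + 1))) • (A.incl q n (by omega) ∘ₗ A.del q n)

/-- The part `γ ↦ (-1)^q dγ` of the total differential (`0` for `q = 0`). -/
def totD (v : ℕ) : ∀ q n, q + n = v + 1 → (A.C q n →ₗ[R] A.Tot v)
  | 0, _, _ => 0
  | q + 1, n, h => ((-1 : ℤ) ^ (q + 1)) • (A.incl q n (by omega) ∘ₗ A.d q n)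

open Classical in
/-- The total differential `δγ = (-1)^{q+n} ∂γ + (-1)^q dγ` for `γ ∈ C_{q,n}`. -/
def delta (v : ℕ) : A.Tot (v + 1) →ₗ[R] A.Tot v :=
  DirectSum.toModule R _ _ fun i => A.totDel v i.1.1 i.1.2 i.2 + A.totD v i.1.1 i.1.2 i.2

/-- Cycles of degree `v`. -/
def cycles : ∀ v : ℕ, Submodule R (A.Tot v)
  | 0 => ⊤
  | v + 1 => LinearMap.ker (A.delta v)

/-- Boundaries of degree `v`. -/
def boundaries (v : ℕ) : Submodule R (A.Tot v) := LinearMap.range (A.delta v)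

/-- The total homology: cycles modulo boundaries. -/
abbrev TotalHomology (v : ℕ) : Type _ := A.cycles v ⧸ (A.boundaries v).submoduleOf (A.cycles v)

end DoubleComplexData

namespace TopGroupoid

variable {M : Type uM} {G : Type uG} [TopologicalSpace M] [TopologicalSpace G]
  {𝒢 : TopGroupoid M G} {R : Type uR} [Ring R]

/-! ## The double complex `C_•(G^(•), 𝓛)` -/

/-- `C_q(G⁽ⁿ⁾, 𝓛)`: finitely supported functions assigning to every `Σ : △_q → G⁽ⁿ⁾` an element of
`𝓛_{λₙ(Σ(a₀))}`. -/
abbrev LocalSystem.Chain (L : LocalSystem.{uM, uG, uR, uL} R 𝒢) (q n : ℕ) : Type _ :=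
  ⨁ S : 𝒢.Simplex q n, L.fib (Simplex.base S)

namespace LocalSystem

variable (L : LocalSystem.{uM, uG, uR, uL} R 𝒢)

open Classical in
/-- The elementary chain `v · Σ`. -/
def elem {q n : ℕ} (S : 𝒢.Simplex q n) : L.fib (Simplex.base S) →ₗ[R] L.Chain q n :=
  DirectSum.lof R (𝒢.Simplex q n) (fun S => L.fib (Simplex.base S)) S

open Classical in
/-- `∂(v·Σ) = ∑_{k=0}^{n-1} (-1)^k v·(d_k ∘ Σ) + (-1)^n (gₙ^Σ)_#⁻¹(v)·(dₙ ∘ Σ)`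
(here with `n + 1` in place of `n`). -/
def del (q n : ℕ) : L.Chain q (n + 1) →ₗ[R] L.Chain q n :=
  DirectSum.toModule R _ _ fun S =>
    (∑ k : Fin (n + 1), ((-1 : ℤ) ^ (k : ℕ)) •
      (L.elem (S.nface k.castSucc) ∘ₗ
        (L.cast (Simplex.base_nface_castSucc k S).symm).toLinearMap)) +
    ((-1 : ℤ) ^ (n + 1)) •
      (L.elem (S.nface (Fin.last (n + 1))) ∘ₗ
        (L.cast (Simplex.base_nface_last S).symm).toLinearMap ∘ₗ
        (L.trEquiv (GPath.arrow S.lastArrow)).symm.toLinearMap ∘ₗ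
        (L.cast (Simplex.s_lastArrow S).symm).toLinearMap)

open Classical in
/-- `d̄(v·Σ) = σ_#(v)·d₀Σ + ∑_{j=1}^{q} (-1)^j v·d_jΣ` (here with `q + 1` in place of `q`), where
`σ(τ) = λₙ(Σ((1 - τ) a₁ + τ a₀))`. -/
def d (q n : ℕ) : L.Chain (q + 1) n →ₗ[R] L.Chain q n :=
  DirectSum.toModule R _ _ fun S =>
    (L.elem (S.sface 0) ∘ₗ
      (L.cast (Simplex.base_sface_zero S).symm).toLinearMap ∘ₗ
      L.tr (GPath.ofPath S.edge)) +
    ∑ j : Fin (q + 1), ((-1 : ℤ) ^ ((j : ℕ) + 1)) •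
      (L.elem (S.sface j.succ) ∘ₗ (L.cast (Simplex.base_sface_succ j S).symm).toLinearMap)

/-- The double complex `C_•(G^(•), 𝓛)`. -/
def doubleComplex : DoubleComplexData R where
  C q n := L.Chain q n
  del := L.del
  d := L.d

end LocalSystem

/-! ## Integral singular chains of the nerve -/

/-- `C_q(G⁽ⁿ⁾, ℤ)`. -/
abbrev IntChain (𝒢 : TopGroupoid M G) (q n : ℕ) : Type _ := 𝒢.Simplex q n →₀ ℤ

namespace IntChain

/-- `∂ = ∑_{k} (-1)^k d_k`. -/
def del (𝒢 : TopGroupoid M G) (q n : ℕ) : 𝒢.IntChain q (n + 1) →ₗ[ℤ] 𝒢.IntChain q n :=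
  ∑ k : Fin (n + 2), ((-1 : ℤ) ^ (k : ℕ)) • Finsupp.lmapDomain ℤ ℤ (Simplex.nface k)

/-- `d = ∑_{j} (-1)^j d_j`. -/
def d (𝒢 : TopGroupoid M G) (q n : ℕ) : 𝒢.IntChain (q + 1) n →ₗ[ℤ] 𝒢.IntChain q n :=
  ∑ j : Fin (q + 2), ((-1 : ℤ) ^ (j : ℕ)) • Finsupp.lmapDomain ℤ ℤ (Simplex.sface j)

/-- The chain map induced by a groupoid morphism, `Σ ↦ φₙ ∘ Σ`. -/
def map {M' : Type*} {G' : Type*} [TopologicalSpace M'] [TopologicalSpace G']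
    {𝒢' : TopGroupoid M' G'} (φ : Hom 𝒢 𝒢') (q n : ℕ) : 𝒢.IntChain q n →ₗ[ℤ] 𝒢'.IntChain q n :=
  Finsupp.lmapDomain ℤ ℤ (Simplex.map φ)

variable {M' : Type*} {G' : Type*} [TopologicalSpace M'] [TopologicalSpace G']
    {𝒢' : TopGroupoid M' G'}

lemma map_del (φ : Hom 𝒢 𝒢') (q n : ℕ) (c : 𝒢.IntChain q (n + 1)) :
    map φ q n (del 𝒢 q n c) = del 𝒢' q n (map φ q (n + 1) c) := by
  simp only [del, map, LinearMap.sum_apply, LinearMap.smul_apply, map_sum, map_smul,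
    Finsupp.lmapDomain_apply, ← Finsupp.mapDomain_comp]
  refine Finset.sum_congr rfl fun k _ => ?_
  congr 2
  funext S
  ext1 z
  exact Nerve.map_face φ k (S z)

lemma map_d (φ : Hom 𝒢 𝒢') (q n : ℕ) (c : 𝒢.IntChain (q + 1) n) :
    map φ q n (d 𝒢 q n c) = d 𝒢' q n (map φ (q + 1) n c) := by
  simp only [d, map, LinearMap.sum_apply, LinearMap.smul_apply, map_sum, map_smul,
    Finsupp.lmapDomain_apply, ← Finsupp.mapDomain_comp]
  rfl

end IntChain

/-! ## Covering spaces over `G` -/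

/-- A covering space `p : E → M` over `G`: a covering space of `M` with a continuous right action
of `G` along `p`, `e · g` being defined for `p e = t g`. -/
structure Covering (𝒢 : TopGroupoid M G) (E : Type uE) [TopologicalSpace E] where
  p : E → M
  isCoveringMap : IsCoveringMap p
  act : ∀ (e : E) (g : G), p e = 𝒢.t g → E
  continuous_act : Continuous fun a : {a : E × G // p a.1 = 𝒢.t a.2} => act a.1.1 a.1.2 a.2
  p_act : ∀ e g h, p (act e g h) = 𝒢.s g
  act_u : ∀ e, act e (𝒢.u (p e)) (𝒢.t_u _).symm = e
  act_mul : ∀ e g h (he : p e = 𝒢.t g) (hgh : 𝒢.s g = 𝒢.t h),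
    act e (𝒢.mul g h hgh) (he.trans (𝒢.t_mul _ _ _).symm) =
      act (act e g he) h ((p_act e g he).trans hgh)

namespace Covering

variable {E : Type uE} [TopologicalSpace E] (P : Covering 𝒢 E)

/-- The arrows `E ×_M G` of the action groupoid. -/
abbrev Arrow : Type _ := {a : E × G // P.p a.1 = 𝒢.t a.2}

/-- The action groupoid `E ⋊ G ⇉ E`, with arrows `(e, g) : e · g → e`. -/
def actionGroupoid : TopGroupoid E P.Arrow where
  s a := P.act a.1.1 a.1.2 a.2
  t a := a.1.1
  u e := ⟨(e, 𝒢.u (P.p e)), (𝒢.t_u _).symm⟩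
  inv a := ⟨(P.act a.1.1 a.1.2 a.2, 𝒢.inv a.1.2), (P.p_act _ _ _).trans (𝒢.t_inv _).symm⟩
  mul a b h := ⟨(a.1.1, 𝒢.mul a.1.2 b.1.2 (by rw [← P.p_act _ _ a.2, h, b.2])),
    a.2.trans (𝒢.t_mul _ _ _).symm⟩
  continuous_s := P.continuous_act
  continuous_t := continuous_fst.comp continuous_subtype_val
  continuous_u := Continuous.subtype_mk
    (continuous_id.prodMk (𝒢.continuous_u.comp P.isCoveringMap.continuous)) _
  continuous_inv := Continuous.subtype_mk
    (P.continuous_act.prodMk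
      (𝒢.continuous_inv.comp (continuous_snd.comp continuous_subtype_val))) _
  continuous_mul := by
    refine Continuous.subtype_mk (Continuous.prodMk (by fun_prop) ?_) _
    exact 𝒢.continuous_mul.comp (Continuous.subtype_mk (f := fun q :
      {q : P.Arrow × P.Arrow // P.act q.1.1.1 q.1.1.2 q.1.2 = q.2.1.1} => (q.1.1.1.2, q.1.2.1.2))
      (by fun_prop) fun q => by rw [← P.p_act _ _ q.1.1.2, q.2, q.1.2.2])
  s_u e := P.act_u e
  t_u _ := rfl
  s_inv a := by
    change P.act (P.act a.1.1 a.1.2 a.2) (𝒢.inv a.1.2) _ = a.1.1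
    rw [← P.act_mul a.1.1 a.1.2 (𝒢.inv a.1.2) a.2 (𝒢.t_inv _).symm]
    have h := P.act_u a.1.1
    simp only [a.2] at h
    simpa only [𝒢.mul_inv] using h
  t_inv _ := rfl
  s_mul a b h := by
    obtain ⟨⟨e, g⟩, ha⟩ := a
    obtain ⟨⟨e', g'⟩, hb⟩ := b
    dsimp only at h ha hb ⊢
    subst h
    exact P.act_mul e g g' ha _
  t_mul _ _ _ := rfl
  mul_assoc a b c h h' := by
    apply Subtype.ext
    exact Prod.ext rfl (𝒢.mul_assoc _ _ _ _ _)
  u_mul a := by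
    apply Subtype.ext
    refine Prod.ext rfl ?_
    simpa only [a.2] using 𝒢.u_mul a.1.2
  mul_u a := by
    apply Subtype.ext
    refine Prod.ext rfl ?_
    simpa only [P.p_act] using 𝒢.mul_u a.1.2
  inv_mul a := by
    apply Subtype.ext
    refine Prod.ext rfl ?_
    simpa only [P.p_act] using 𝒢.inv_mul a.1.2
  mul_inv a := by
    apply Subtype.ext
    refine Prod.ext rfl ?_
    simpa only [a.2] using 𝒢.mul_inv a.1.2

/-- The morphism `p : E ⋊ G → G`, `(e, g) ↦ g`, covering `p : E → M`. -/
def proj : Hom P.actionGroupoid 𝒢 where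
  obj := P.p
  arr a := a.1.2
  continuous_obj := P.isCoveringMap.continuous
  continuous_arr := continuous_snd.comp continuous_subtype_val
  s_arr a := (P.p_act _ _ _).symm
  t_arr a := a.2.symm
  arr_u _ := rfl
  arr_mul _ _ _ := rfl

/-- `E` is universal: the action groupoid is connected and has trivial fundamental groups. -/
def IsUniversal : Prop := P.actionGroupoid.IsSimplyConnected

/-- `Γ^G(E)`: equivariant automorphisms of the covering space `E` over `G`. -/
structure Deck where
  toHomeomorph : E ≃ₜ E
  p_apply : ∀ e, P.p (toHomeomorph e) = P.p e
  act_apply : ∀ e g (h : P.p e = 𝒢.t g), toHomeomorph (P.act e g h) =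
    P.act (toHomeomorph e) g ((p_apply e).trans h)

namespace Deck

variable {P}

/-- The automorphism `(e, g) ↦ (f e, g)` of `E ⋊ G` induced by `f`. -/
def hom (f : P.Deck) : Hom P.actionGroupoid P.actionGroupoid where
  obj := f.toHomeomorph
  arr a := ⟨(f.toHomeomorph a.1.1, a.1.2), (f.p_apply _).trans a.2⟩
  continuous_obj := f.toHomeomorph.continuous
  continuous_arr := by fun_prop
  s_arr a := (f.act_apply _ _ _).symm
  t_arr _ := rfl
  arr_u e := by
    apply Subtype.ext
    refine Prod.ext rfl ?_
    change 𝒢.u (P.p e) = 𝒢.u (P.p (f.toHomeomorph e))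
    rw [f.p_apply]
  arr_mul _ _ _ := rfl

/-- The loop `p_*(σ̃)` at `x₀ = p e₀`, where `σ̃` is an `E ⋊ G`-path from `e₀` to `f e₀`. -/
def projLoop (f : P.Deck) (e₀ : E) (σ : GPath P.actionGroupoid e₀ (f.toHomeomorph e₀)) :
    GPath 𝒢 (P.p e₀) (P.p e₀) :=
  GPath.castEnd (f.p_apply e₀) (σ.map P.proj)

/-- A representing loop of `β(f) ∈ Π₁(G, x₀)`: `p_*(σ̃)` for some `E ⋊ G`-path `σ̃` from `e₀` to
`f e₀`. For a universal `E` the class does not depend on `σ̃`. -/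
def loop (hE : P.IsUniversal) (e₀ : E) (f : P.Deck) : GPath 𝒢 (P.p e₀) (P.p e₀) :=
  f.projLoop e₀ (hE.1 e₀ (f.toHomeomorph e₀)).some

/-- The right action of `Γ^G(E)` on `𝓛₀ = 𝓛_{x₀}`, `v · f = (σ_#)⁻¹(v)` for `β(f) = [σ]`. -/
def fibAct (hE : P.IsUniversal) (e₀ : E) (L : LocalSystem.{uM, uG, uR, uL} R 𝒢) (f : P.Deck) :
    L.fib (P.p e₀) ≃ₗ[R] L.fib (P.p e₀) :=
  (L.trEquiv (f.loop hE e₀)).symm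

/-- `v · f` may be computed from any `E ⋊ G`-path from `e₀` to `f e₀`. -/
lemma fibAct_eq (hE : P.IsUniversal) (e₀ : E) (L : LocalSystem.{uM, uG, uR, uL} R 𝒢) (f : P.Deck)
    (σ : GPath P.actionGroupoid e₀ (f.toHomeomorph e₀)) :
    f.fibAct hE e₀ L = (L.trEquiv (f.projLoop e₀ σ)).symm := by
  have key : ∀ {e e' : E} (σ σ' : GPath P.actionGroupoid e e'),
      L.tr (σ.map P.proj) = L.tr (σ'.map P.proj) := by
    intro e e' σ σ'
    obtain ⟨τ⟩ := hE.1 e' e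
    have hq := (hE.2 e).elim (Quot.mk _ (σ.concat τ)) (Quot.mk _ (σ'.concat τ))
    have hh : (σ.concat τ).Homotopic (σ'.concat τ) :=
      (Equivalence.eqvGen_iff (Relation.EqvGen.is_equivalence _)).1 (Quot.eqvGen_exact hq)
    have := L.tr_homotopic _ _ (hh.map P.proj)
    rw [GPath.map_concat, GPath.map_concat, L.tr_concat, L.tr_concat] at this
    refine LinearMap.ext fun v => ?_
    obtain ⟨w, rfl⟩ := (L.tr_bijective (τ.map P.proj)).2 v
    exact LinearMap.congr_fun this w
  have cast_tr : ∀ {x y y' : M} (h : y = y') (σ σ' : GPath 𝒢 x y), L.tr σ = L.tr σ' →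
      L.trEquiv (GPath.castEnd h σ) = L.trEquiv (GPath.castEnd h σ') := by
    intro x y y' h σ σ' hs
    subst h
    exact LinearEquiv.ext fun v => LinearMap.congr_fun hs v
  unfold fibAct loop projLoop
  exact congrArg LinearEquiv.symm (cast_tr (f.p_apply e₀) _ _ (key _ σ))

end Deck

/-! ## The double complex `𝓛₀ ⊗_{Γ^G(E)} C_•(E^(•), ℤ)` -/

section Tensor

variable (hE : P.IsUniversal) (e₀ : E) (L : LocalSystem.{uM, uG, uR, uL} R 𝒢)

/-- `𝓛₀ ⊗ C_q(E⁽ⁿ⁾, ℤ)`, an `R`-module through `𝓛₀`; here `E⁽ⁿ⁾` is the nerve of `E ⋊ G`. -/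
abbrev TensorChain (q n : ℕ) : Type _ := L.fib (P.p e₀) ⊗[ℤ] P.actionGroupoid.IntChain q n

/-- The submodule `Q_q(𝓛₀, E⁽ⁿ⁾)` generated by all `v·f ⊗ c - v ⊗ f·c`. -/
def Q (q n : ℕ) : Submodule R (P.TensorChain e₀ L q n) :=
  Submodule.span R {w | ∃ (v : L.fib (P.p e₀)) (f : P.Deck) (c : P.actionGroupoid.IntChain q n),
    w = f.fibAct hE e₀ L v ⊗ₜ[ℤ] c - v ⊗ₜ[ℤ] IntChain.map f.hom q n c}

/-- `id ⊗ ∂`. -/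
def tensorDel (q n : ℕ) : P.TensorChain e₀ L q (n + 1) →ₗ[R] P.TensorChain e₀ L q n :=
  TensorProduct.AlgebraTensorModule.map LinearMap.id (IntChain.del P.actionGroupoid q n)

/-- `id ⊗ d`. -/
def tensorD (q n : ℕ) : P.TensorChain e₀ L (q + 1) n →ₗ[R] P.TensorChain e₀ L q n :=
  TensorProduct.AlgebraTensorModule.map LinearMap.id (IntChain.d P.actionGroupoid q n)

lemma Q_le_del (q n : ℕ) :
    P.Q hE e₀ L q (n + 1) ≤ (P.Q hE e₀ L q n).comap (P.tensorDel e₀ L q n) := by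
  refine Submodule.span_le.2 ?_
  rintro _ ⟨v, f, c, rfl⟩
  refine Submodule.subset_span ⟨v, f, IntChain.del _ q n c, ?_⟩
  rw [IntChain.map_del, map_sub]
  rfl

lemma Q_le_d (q n : ℕ) :
    P.Q hE e₀ L (q + 1) n ≤ (P.Q hE e₀ L q n).comap (P.tensorD e₀ L q n) := by
  refine Submodule.span_le.2 ?_
  rintro _ ⟨v, f, c, rfl⟩
  refine Submodule.subset_span ⟨v, f, IntChain.d _ q n c, ?_⟩
  rw [IntChain.map_d, map_sub]
  rfl

/-- The double complex `𝓛₀ ⊗_{Γ^G(E)} C_•(E^(•), ℤ)`. -/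
def equivariantDoubleComplex : DoubleComplexData R where
  C q n := P.TensorChain e₀ L q n ⧸ P.Q hE e₀ L q n
  del q n := Submodule.mapQ _ _ (P.tensorDel e₀ L q n) (P.Q_le_del hE e₀ L q n)
  d q n := Submodule.mapQ _ _ (P.tensorD e₀ L q n) (P.Q_le_d hE e₀ L q n)

end Tensor

end Covering

end TopGroupoid

end

noncomputable section

namespace TopGroupoid

variable {M : Type uM} {G : Type uG} [TopologicalSpace M] [TopologicalSpace G]
  {𝒢 : TopGroupoid M G}

/-! ### The right action of `G` on `E` -/

namespace Covering

variable {E : Type uE} [TopologicalSpace E] (P : Covering 𝒢 E)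

/-! The isomorphism sends the class of `v ⊗ Σ` to `w · (p ∘ Σ)`. Here `w` is obtained from `v ∈ 𝓛₀`
by inverse transport along the projection of an `E ⋊ G`-path from `e₀` to the base point of `Σ`. Two
such paths have the same transport because `E ⋊ G` is simply connected (`tr_projPath_eq`). The
relation `v·f ⊗ c = v ⊗ f·c` is respected: a path from `e₀` to `f e₀`, followed by the image under
`f` of a path from `e₀` to `e`, ends at `f e`, and its second half has the same projection as the
path to `e` (`fibAct_transport`).

For the inverse, a simplex of the nerve of `G` is lifted to `E`. The initial vertex lifts because a
simplex is contractible, and the arrows then determine all other vertices (`exists_map_proj_eq`).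
The class of the lift is well defined because two lifts differ by a deck transformation
(`exists_deck_map_eq`), which rests on the transitivity of the deck group on fibres (`exists_deck`).
As in classical covering theory, the deck transformation is built from monodromy, here along
`G`-paths. Monodromy is invariant under `G`-homotopy (`monodromy_homotopic`), hence trivial along
projected loops of `E ⋊ G`. Continuity uses that `M` is locally path connected.

Only two faces move the base point of a simplex: the last nerve face moves it along the arrow `gₙ`,
and the zeroth singular face along the edge `a₁a₀`. These movements lift to `E ⋊ G`-paths, so the
compatibility of transports with such paths produces exactly the twists in `∂` and `d̄`. The double
complex identities hold for integral chains by the simplicial identities, descend to the tensor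
quotient, and are carried to `C_•(G^(•), 𝓛)` by the isomorphism. The statement on total homology is
then formal. -/

lemma act_congr {e e' : E} {g g' : G} (he : e = e') (hg : g = g') (h : P.p e = 𝒢.t g) :
    P.act e g h = P.act e' g' (by rw [← he, ← hg, h]) := by
  subst he hg; rfl

lemma act_unit {e : E} {g : G} (h : P.p e = 𝒢.t g) (hg : g = 𝒢.u (P.p e)) : P.act e g h = e := by
  subst hg; exact P.act_u e

lemma act_act_inv (e : E) (g : G) (h : P.p e = 𝒢.t g) (h' : P.p (P.act e g h) = 𝒢.t (𝒢.inv g)) :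
    P.act (P.act e g h) (𝒢.inv g) h' = e := by
  rw [← P.act_mul e g (𝒢.inv g) h (𝒢.t_inv g).symm]
  exact P.act_unit _ (by rw [𝒢.mul_inv, h])

lemma act_inv_act (e : E) (g : G) (h : P.p e = 𝒢.t (𝒢.inv g))
    (h' : P.p (P.act e (𝒢.inv g) h) = 𝒢.t g) :
    P.act (P.act e (𝒢.inv g) h) g h' = e := by
  rw [← P.act_mul e (𝒢.inv g) g h (𝒢.s_inv g)]
  exact P.act_unit _ (by rw [𝒢.inv_mul, h, 𝒢.t_inv])

/-! ## Monodromy along `G`-paths -/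

/-- The monodromy of a covering along a path of the base. -/
def pathMonodromy {x y : M} (σ : Path x y) : P.p ⁻¹' {x} → P.p ⁻¹' {y} :=
  P.isCoveringMap.monodromy (Path.Homotopic.Quotient.mk σ)

/-- Lifts with a given starting point are unique, so any lift at hand computes the monodromy. -/
lemma pathMonodromy_eq {x y : M} (σ : Path x y) {e : P.p ⁻¹' {x}} {e' : P.p ⁻¹' {y}}
    (Γ : C(unitInterval, E)) (h : ∀ r, P.p (Γ r) = σ r) (h0 : Γ 0 = e) (h1 : Γ 1 = e') :
    P.pathMonodromy σ e = e' := by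
  have hσ : σ.toContinuousMap 0 = P.p e := σ.source.trans e.2.symm
  have := (P.isCoveringMap.eq_liftPath_iff' hσ).mpr ⟨funext h, h0⟩
  apply Subtype.ext
  change P.isCoveringMap.liftPath _ _ hσ 1 = _
  rw [← this, h1]

lemma exists_lift_path {x y : M} (σ : Path x y) (e : P.p ⁻¹' {x}) :
    ∃ Γ : Path (e : E) (P.pathMonodromy σ e : E), ∀ r, P.p (Γ r) = σ r := by
  have hσ : σ.toContinuousMap 0 = P.p e := σ.source.trans e.2.symm
  exact ⟨⟨P.isCoveringMap.liftPath _ _ hσ, P.isCoveringMap.liftPath_zero _ _ _, rfl⟩,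
    fun r => congrFun (P.isCoveringMap.liftPath_lifts _ _ hσ) r⟩

lemma pathMonodromy_refl {x : M} (e : P.p ⁻¹' {x}) : P.pathMonodromy (Path.refl x) e = e :=
  P.pathMonodromy_eq _ (.const _ e.1) (fun _ => e.2) rfl rfl

lemma pathMonodromy_trans {x y z : M} (σ : Path x y) (σ' : Path y z) (e : P.p ⁻¹' {x}) :
    P.pathMonodromy (σ.trans σ') e = P.pathMonodromy σ' (P.pathMonodromy σ e) :=
  P.isCoveringMap.monodromy_trans_apply (.mk σ) (.mk σ') e

/-- Monodromy along the boundary of a square whose initial edge is lifted to `α`. -/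
lemma pathMonodromy_square {w w' z z' : M} (σ : Path w z) (σ' : Path w' z') (δ : Path z z')
    (D : C(unitInterval × unitInterval, M)) (h0 : ∀ r, D (0, r) = σ r)
    (h1 : ∀ r, D (1, r) = σ' r) (α : C(unitInterval, E)) (hα : ∀ τ, P.p (α τ) = D (τ, 0))
    (hδ : ∀ τ, D (τ, 1) = δ τ) (e : P.p ⁻¹' {w}) (e' : P.p ⁻¹' {w'}) (he : α 0 = e)
    (he' : α 1 = e') :
    P.pathMonodromy δ (P.pathMonodromy σ e) = P.pathMonodromy σ' e' := by
  -- The known lift `α` lies over the edge `r = 0`, so the homotopy is lifted in the direction of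
  -- `r`, the second variable of `D`; hence the swap.
  let H : C(unitInterval × unitInterval, M) := D.comp .prodSwap
  have hH : ∀ a, H (0, a) = P.p (α a) := fun a => (hα a).symm
  let F := P.isCoveringMap.liftHomotopy H α hH
  have hF : ∀ r τ, P.p (F (r, τ)) = D (τ, r) := fun r τ =>
    congrFun (P.isCoveringMap.liftHomotopy_lifts H α hH) (r, τ)
  have hF0 : ∀ τ, F (0, τ) = α τ := P.isCoveringMap.liftHomotopy_zero H α hH
  -- The other three sides of the lifted square are lifts of `σ`, `σ'` and `δ`, and they meet in its
  -- corners.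
  have e1 : P.pathMonodromy σ e = ⟨F (1, 0), by
      rw [Set.mem_preimage, hF, h0]; exact σ.target⟩ :=
    P.pathMonodromy_eq σ ⟨fun r => F (r, 0), by fun_prop⟩ (fun r => (hF r 0).trans (h0 r))
      ((hF0 0).trans he) rfl
  have e2 : P.pathMonodromy σ' e' = ⟨F (1, 1), by
      rw [Set.mem_preimage, hF, h1]; exact σ'.target⟩ :=
    P.pathMonodromy_eq σ' ⟨fun r => F (r, 1), by fun_prop⟩ (fun r => (hF r 1).trans (h1 r))
      ((hF0 1).trans he') rfl
  rw [e1, e2]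
  exact P.pathMonodromy_eq δ ⟨fun τ => F (1, τ), by fun_prop⟩ (fun τ => (hF 1 τ).trans (hδ τ))
    rfl rfl

/-- The monodromy `e ↦ e · g⁻¹` along an arrow. -/
def arrowMonodromy {y y' : M} (g : G) (hs : 𝒢.s g = y) (ht : 𝒢.t g = y') (e : P.p ⁻¹' {y}) :
    P.p ⁻¹' {y'} :=
  ⟨P.act e (𝒢.inv g) (by rw [𝒢.t_inv, hs]; exact e.2), by
    rw [Set.mem_preimage, P.p_act, 𝒢.s_inv, ht]; rfl⟩

/-- Acting by `g` undoes the monodromy along `g`. This criterion keeps inverses out of the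
computations for units and products. -/
lemma arrowMonodromy_eq {y y' : M} (g : G) (hs : 𝒢.s g = y) (ht : 𝒢.t g = y')
    {e : P.p ⁻¹' {y}} {e' : P.p ⁻¹' {y'}} (h : P.act e' g (e'.2.trans ht.symm) = e) :
    P.arrowMonodromy g hs ht e = e' := by
  obtain ⟨e, he⟩ := e
  apply Subtype.ext
  dsimp only at h
  subst h
  exact P.act_act_inv _ _ _ _

lemma act_arrowMonodromy {y y' : M} (g : G) (hs : 𝒢.s g = y) (ht : 𝒢.t g = y')
    (e : P.p ⁻¹' {y}) :
    P.act (P.arrowMonodromy g hs ht e) g ((P.arrowMonodromy g hs ht e).2.trans ht.symm) = e :=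
  P.act_inv_act _ _ _ _

lemma arrowMonodromy_u {y : M} (e : P.p ⁻¹' {y}) :
    P.arrowMonodromy (𝒢.u y) (𝒢.s_u y) (𝒢.t_u y) e = e :=
  P.arrowMonodromy_eq _ _ _ (P.act_unit _ (by rw [show P.p e = y from e.2]))

lemma arrowMonodromy_mul {y y' z : M} (g h : G) (hg : 𝒢.s g = y) (hg' : 𝒢.t g = y')
    (hh : 𝒢.s h = y') (hh' : 𝒢.t h = z) (e : P.p ⁻¹' {y}) :
    P.arrowMonodromy (𝒢.mul h g (hh.trans hg'.symm)) ((𝒢.s_mul _ _ _).trans hg)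
      ((𝒢.t_mul _ _ _).trans hh') e =
    P.arrowMonodromy h hh hh' (P.arrowMonodromy g hg hg' e) := by
  refine P.arrowMonodromy_eq _ _ _ ?_
  rw [P.act_mul _ h g ((P.arrowMonodromy h hh hh' _).2.trans hh'.symm)]
  rw [P.act_congr (P.act_arrowMonodromy h hh hh' _) rfl]
  exact P.act_arrowMonodromy _ _ _ _

/-- The monodromy along a `G`-path. -/
def monodromy {x : M} : ∀ {y : M}, GPath 𝒢 x y → P.p ⁻¹' {x} → P.p ⁻¹' {y}
  | _, .ofPath σ, e => P.pathMonodromy σ e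
  | _, .snoc τ g hs ht σ, e => P.pathMonodromy σ (P.arrowMonodromy g hs ht (monodromy τ e))

/-- Induction on the order of the `G`-paths. The terminal point must be allowed to move along `γ`,
since removing the last arrow and path leaves an initial piece whose end moves even when the ends of
the whole family are fixed. -/
lemma monodromy_deforms {x y y' : M} {σ : GPath 𝒢 x y} {σ' : GPath 𝒢 x y'} {γ : Path y y'}
    (h : GPath.Deforms σ σ' γ) (e : P.p ⁻¹' {x}) :
    P.pathMonodromy γ (P.monodromy σ e) = P.monodromy σ' e := by
  induction h with
  | ofPath σ σ' γ D h0 h1 hs ht =>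
    exact P.pathMonodromy_square σ σ' γ D h0 h1 (.const _ e.1) (fun τ => by rw [hs]; exact e.2) ht
      e e rfl rfl
  | snoc h d hs ht hs' ht' hd σ σ' δ D h0 h1 hDs hDt ih =>
    -- The moving end of the initial piece is lifted to `E`. Acting by the inverses of the arrows `d
    -- τ` turns this into a lift of the edge `r = 0` of the last square, whose end is correct by the
    -- induction hypothesis.
    obtain ⟨Γ, hΓ⟩ := P.exists_lift_path _ (P.monodromy _ e)
    have hc : ∀ τ, P.p (Γ τ) = 𝒢.t (𝒢.inv (d τ)) := fun τ => by rw [𝒢.t_inv, hΓ, hd]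
    let α : C(unitInterval, E) := ⟨fun τ => P.act (Γ τ) (𝒢.inv (d τ)) (hc τ),
      P.continuous_act.comp (Continuous.subtype_mk
        (Γ.continuous.prodMk (𝒢.continuous_inv.comp d.continuous)) hc)⟩
    refine P.pathMonodromy_square σ σ' δ D h0 h1 α ?_ hDt _ _ ?_ ?_
    · intro τ
      exact (P.p_act _ _ _).trans ((𝒢.s_inv _).trans (hDs τ).symm)
    · exact P.act_congr Γ.source (by rw [d.source]) _
    · refine P.act_congr (Γ.target.trans (congrArg Subtype.val ih)) (by rw [d.target]) _

lemma monodromy_step {x y : M} {σ σ' : GPath 𝒢 x y} (h : GPath.Step σ σ') (e : P.p ⁻¹' {x}) :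
    P.monodromy σ e = P.monodromy σ' e := by
  induction h with
  | mul τ g h hg hg' hh hh' σ =>
    simp only [monodromy]
    rw [P.pathMonodromy_refl, P.arrowMonodromy_mul g h hg hg' hh hh']
  | concat_ofPath σ σ' =>
    simp only [monodromy]
    rw [P.arrowMonodromy_u, P.pathMonodromy_trans]
  | concat_snoc τ g hg hg' σ σ' =>
    simp only [monodromy]
    rw [P.arrowMonodromy_u, P.pathMonodromy_trans]
  | snoc_congr h g hg hg' σ ih => simp only [monodromy, ih]
  | deform h => rw [← P.monodromy_deforms h, P.pathMonodromy_refl]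

/-- The monodromy depends only on the `G`-homotopy class. -/
lemma monodromy_homotopic {x y : M} {σ σ' : GPath 𝒢 x y} (h : σ.Homotopic σ') :
    P.monodromy σ = P.monodromy σ' := by
  induction h with
  | rel _ _ h => exact funext fun e => P.monodromy_step h e
  | refl _ => rfl
  | symm _ _ _ ih => exact ih.symm
  | trans _ _ _ _ _ ih ih' => exact ih.trans ih'

lemma monodromy_concat {x y z : M} (σ : GPath 𝒢 x y) (σ' : GPath 𝒢 y z) (e : P.p ⁻¹' {x}) :
    P.monodromy (σ.concat σ') e = P.monodromy σ' (P.monodromy σ e) := by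
  induction σ' with
  | ofPath ρ => simp only [GPath.concat, monodromy, P.arrowMonodromy_u]
  | snoc τ g hs ht ρ ih => simp only [GPath.concat, monodromy, ih]

/-- The monodromy along the projection of an `E ⋊ G`-path from `e` to `e'` maps `e` to `e'`. -/
lemma monodromy_map_proj {e e' : E} (ρ : GPath P.actionGroupoid e e') :
    P.monodromy (ρ.map P.proj) ⟨e, rfl⟩ = ⟨e', rfl⟩ := by
  induction ρ with
  -- A path in `E` is itself a lift of its projection.
  | ofPath σ => exact P.pathMonodromy_eq _ σ.toContinuousMap (fun _ => rfl) σ.source σ.target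
  | snoc τ a hs ht σ ih =>
    subst hs ht
    simp only [GPath.map, monodromy, ih]
    refine P.pathMonodromy_eq _ σ.toContinuousMap (fun _ => rfl) ?_ σ.target
    exact σ.source.trans (congrArg Subtype.val (P.arrowMonodromy_eq (y := P.p (P.actionGroupoid.s a))
      (e := ⟨P.actionGroupoid.s a, rfl⟩) (e' := ⟨a.1.1, rfl⟩) a.1.2 _ a.2.symm rfl)).symm

/-- `G`-paths lift to `E ⋊ G`-paths. -/
lemma exists_lift_gpath {e : E} {y : M} (κ : GPath 𝒢 (P.p e) y) :
    ∃ (e' : E) (h : P.p e' = y) (ρ : GPath P.actionGroupoid e e'),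
      GPath.castEnd h (ρ.map P.proj) = κ := by
  have hpath : ∀ {x y : M} (σ : Path x y) (e : E) (h : P.p e = x), ∃ (e' : E) (h' : P.p e' = y)
      (Γ : Path e e'), (Γ.map P.isCoveringMap.continuous).cast h.symm h'.symm = σ := by
    intro x y σ e h
    obtain ⟨Γ, hΓ⟩ := P.exists_lift_path σ ⟨e, h⟩
    exact ⟨_, (P.pathMonodromy σ ⟨e, h⟩).2, Γ, Path.ext (funext hΓ)⟩
  induction κ with
  | ofPath σ =>
    obtain ⟨e', rfl, Γ, rfl⟩ := hpath σ e rfl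
    exact ⟨e', rfl, .ofPath Γ, rfl⟩
  | snoc τ g hs ht σ ih =>
    obtain ⟨e', rfl, ρ, rfl⟩ := ih
    subst ht
    obtain ⟨e'', rfl, Γ, rfl⟩ := hpath σ (P.arrowMonodromy g hs rfl ⟨e', rfl⟩)
      (P.arrowMonodromy g hs rfl ⟨e', rfl⟩).2
    -- The action groupoid has arrows `(e, g) : e · g → e`, so the lift of `g` with source `e'` has
    -- target `e' · g⁻¹`.
    let a : P.Arrow := ⟨(P.arrowMonodromy g hs rfl ⟨e', rfl⟩, g),
      (P.arrowMonodromy g hs rfl ⟨e', rfl⟩).2⟩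
    refine ⟨e'', rfl, .snoc ρ a (P.act_arrowMonodromy g hs rfl ⟨e', rfl⟩) rfl Γ, ?_⟩
    -- The projected last piece starts at the image of the new vertex, which equals `t g` only
    -- propositionally; the difference is absorbed by a cast of the path.
    have key : ∀ {x y w z z' : M} (τ : GPath 𝒢 x y) (hs : 𝒢.s g = y) (ht : 𝒢.t g = z)
        (ht' : 𝒢.t g = z') (hz : z' = z) (σ : Path z w),
        GPath.snoc τ g hs ht σ = GPath.snoc τ g hs ht' (σ.cast hz rfl) := by
      intro x y w z z' τ hs ht ht' hz σ
      subst hz; rfl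
    exact key _ _ _ _ _ _

end Covering

end TopGroupoid

namespace TopGroupoid

variable {M : Type uM} {G : Type uG} [TopologicalSpace M] [TopologicalSpace G]
  {𝒢 : TopGroupoid M G}

namespace Covering

variable {E : Type uE} [TopologicalSpace E] {P : Covering 𝒢 E}

/-! ## Deck transformations of the universal covering -/

/-- The total space of a covering of a locally path connected space is locally path connected. -/
lemma locallyPathConnectedSpace (P : Covering 𝒢 E) [LocallyPathConnectedSpace M] :
    LocallyPathConnectedSpace E := by
  choose φ hφ _ using P.isCoveringMap.isLocalHomeomorph
  let _ : ChartedSpace M E :=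
    { atlas := Set.range φ
      chartAt := φ
      mem_chart_source := hφ
      chart_mem_atlas := fun e => ⟨e, rfl⟩ }
  exact ChartedSpace.locallyPathConnectedSpace M E

/-- A form of path lifting without casts: instead of equating the projection of `ρ` with `κ`, whose
endpoints have different types of description, it compares their monodromies on the whole fibre. -/
lemma exists_lift_gpath_monodromy (P : Covering 𝒢 E) {x y : M} (κ : GPath 𝒢 x y)
    (e : P.p ⁻¹' {x}) :
    ∃ (e' : E) (ρ : GPath P.actionGroupoid e e'), e' = P.monodromy κ e ∧
      ∀ f : P.p ⁻¹' {x},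
        (P.monodromy (ρ.map P.proj) ⟨f, f.2.trans e.2.symm⟩ : E) = P.monodromy κ f := by
  obtain ⟨e, rfl⟩ := e
  obtain ⟨e', rfl, ρ, rfl⟩ := P.exists_lift_gpath κ
  exact ⟨e', ρ, (congrArg Subtype.val (P.monodromy_map_proj ρ)).symm, fun _ => rfl⟩

namespace IsUniversal

lemma homotopic_loop (hE : P.IsUniversal) {e : E} (ρ ρ' : GPath P.actionGroupoid e e) : ρ.Homotopic ρ' :=
  (Equivalence.eqvGen_iff (Relation.EqvGen.is_equivalence _)).1
    (Quot.eqvGen_exact ((hE.2 e).elim (Quot.mk _ ρ) (Quot.mk _ ρ')))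

/-- The loop contracts in `E ⋊ G`, and the contraction projects to `G`. So the projected loop fixes
every point of the fibre, not just the point `e` through which it was lifted. -/
lemma monodromy_loop (hE : P.IsUniversal) {e : E} (ρ : GPath P.actionGroupoid e e) (f : P.p ⁻¹' {P.p e}) :
    P.monodromy (ρ.map P.proj) f = f := by
  rw [P.monodromy_homotopic ((hE.homotopic_loop ρ (.const _ e)).map P.proj)]
  exact P.pathMonodromy_refl f

/-- A return path `τ` closes both `ρ'` and `ρ` to loops, so both monodromies are inverse to that of
`τ`. -/
lemma monodromy_eq (hE : P.IsUniversal) {e e' : E} (ρ ρ' : GPath P.actionGroupoid e e') :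
    P.monodromy (ρ.map P.proj) = P.monodromy (ρ'.map P.proj) := by
  obtain ⟨τ⟩ := hE.1 e' e
  funext f
  have h1 : P.monodromy (τ.map P.proj) (P.monodromy (ρ'.map P.proj) f) = f := by
    have := hE.monodromy_loop (ρ'.concat τ) f
    rwa [GPath.map_concat, P.monodromy_concat] at this
  have h2 : ∀ b, P.monodromy (ρ.map P.proj) (P.monodromy (τ.map P.proj) b) = b := fun b => by
    have := hE.monodromy_loop (τ.concat ρ) b
    rwa [GPath.map_concat, P.monodromy_concat] at this
  exact (congrArg _ h1).symm.trans (h2 _)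

end IsUniversal

section Deck

variable (hE : P.IsUniversal) (e₁ e₂ : E) (h : P.p e₂ = P.p e₁)

/-- The map of `E` sending the endpoint of an `E ⋊ G`-path `ρ` from `e₁` to the endpoint of the lift
of `p_*(ρ)` from `e₂`. -/
def deckFun (e : E) : E := P.monodromy ((hE.1 e₁ e).some.map P.proj) ⟨e₂, h⟩

lemma deckFun_eq {e : E} (ρ : GPath P.actionGroupoid e₁ e) :
    deckFun hE e₁ e₂ h e = P.monodromy (ρ.map P.proj) ⟨e₂, h⟩ := by
  rw [deckFun, hE.monodromy_eq _ ρ]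

lemma p_deckFun (e : E) : P.p (deckFun hE e₁ e₂ h e) = P.p e :=
  (P.monodromy ((hE.1 e₁ e).some.map P.proj) ⟨e₂, h⟩).2

lemma deckFun_self : deckFun hE e₁ e₂ h e₁ = e₂ := by
  rw [deckFun_eq hE e₁ e₂ h (.const _ e₁)]
  exact congrArg Subtype.val (P.pathMonodromy_refl _)

/-- Follows by extending a path from `e₁` to `e` by `ρ`. Equivariance is the case where `ρ` is an
arrow, and continuity uses the case of a path in a small neighbourhood. -/
lemma deckFun_gpath {e e' : E} (ρ : GPath P.actionGroupoid e e') :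
    deckFun hE e₁ e₂ h e' =
      P.monodromy (ρ.map P.proj) ⟨deckFun hE e₁ e₂ h e, p_deckFun hE e₁ e₂ h e⟩ := by
  obtain ⟨τ⟩ := hE.1 e₁ e
  rw [deckFun_eq hE e₁ e₂ h (τ.concat ρ), GPath.map_concat, P.monodromy_concat]
  congr 2
  exact Subtype.ext (deckFun_eq hE e₁ e₂ h τ).symm

lemma deckFun_act (e : E) (g : G) (hg : P.p e = 𝒢.t g) :
    deckFun hE e₁ e₂ h (P.act e g hg) =
      P.act (deckFun hE e₁ e₂ h e) g ((p_deckFun hE e₁ e₂ h e).trans hg) := by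
  let a : P.Arrow := ⟨(e, g), hg⟩
  -- The arrow `(e, g)` runs from `e · g` to `e`. The resulting formula expresses the image of `e`
  -- through that of `e · g`, and acting by `g` inverts it.
  have key := deckFun_gpath hE e₁ e₂ h (GPath.arrow (𝒢 := P.actionGroupoid) a)
  have h1 : P.monodromy ((GPath.arrow (𝒢 := P.actionGroupoid) a).map P.proj)
      ⟨_, p_deckFun hE e₁ e₂ h (P.act e g hg)⟩ =
      P.arrowMonodromy g (P.p_act e g hg).symm hg.symm
        ⟨_, p_deckFun hE e₁ e₂ h (P.act e g hg)⟩ := by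
    refine (P.pathMonodromy_refl _).trans ?_
    refine congrArg (P.arrowMonodromy g (P.p_act e g hg).symm hg.symm) ?_
    exact P.pathMonodromy_refl _
  exact ((P.act_congr (key.trans (congrArg Subtype.val h1)) rfl _).trans
    (P.act_arrowMonodromy g (P.p_act e g hg).symm hg.symm
      ⟨_, p_deckFun hE e₁ e₂ h (P.act e g hg)⟩)).symm

/-- Let `ρ'` be the lift from `e₂` of the projection of `ρ`. Lifting the projection of `ρ'` from
`e₁` gives back the endpoint of `ρ`. -/
lemma deckFun_deckFun (e : E) :
    deckFun hE e₂ e₁ h.symm (deckFun hE e₁ e₂ h e) = e := by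
  obtain ⟨ρ⟩ := hE.1 e₁ e
  obtain ⟨e', ρ', he', hρ'⟩ := P.exists_lift_gpath_monodromy (ρ.map P.proj) ⟨e₂, h⟩
  rw [deckFun_eq hE e₁ e₂ h ρ, ← he', deckFun_eq hE e₂ e₁ h.symm ρ', hρ' ⟨e₁, rfl⟩,
    P.monodromy_map_proj]

/-- Near `e` the map is `p` followed by a local section of `p` through the image of `e`. Indeed, a
nearby point is joined to `e` by a path whose projection stays in the domain of the section, and the
section lifts this projection. -/
lemma continuous_deckFun [LocallyPathConnectedSpace M] : Continuous (deckFun hE e₁ e₂ h) := by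
  have := P.locallyPathConnectedSpace
  refine continuous_iff_continuousAt.2 fun e => ?_
  obtain ⟨φ, hφ, hφp⟩ := P.isCoveringMap.isLocalHomeomorph (deckFun hE e₁ e₂ h e)
  have hpe : φ (deckFun hE e₁ e₂ h e) = P.p e := by rw [← hφp, p_deckFun]
  have he : P.p e ∈ φ.target := hpe ▸ φ.map_source hφ
  obtain ⟨W, ⟨heW, hW⟩, hWφ⟩ := (path_connected_basis e).mem_iff.mp
    ((φ.open_target.preimage P.isCoveringMap.continuous).mem_nhds he)
  refine ContinuousAt.congr (f := φ.symm ∘ P.p)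
    ((φ.continuousAt_symm he).comp P.isCoveringMap.continuous.continuousAt) ?_
  refine Filter.mem_of_superset heW fun e' he' => ?_
  obtain ⟨γ, hγ⟩ := hW.joinedIn _ (mem_of_mem_nhds heW) _ he'
  have hγφ : ∀ r, P.p (γ r) ∈ φ.target := fun r => hWφ (hγ r)
  let Γ : C(unitInterval, E) := ⟨fun r => φ.symm (P.p (γ r)),
    φ.continuousOn_symm.comp_continuous (P.isCoveringMap.continuous.comp γ.continuous) hγφ⟩
  have hΓ : ∀ r, P.p (Γ r) = P.p (γ r) := fun r => by
    change P.p (φ.symm (P.p (γ r))) = _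
    rw [hφp, φ.right_inv]
    rw [← hφp]; exact hγφ r
  have h1 : Γ 1 = φ.symm (P.p e') := by
    change φ.symm (P.p (γ 1)) = _
    rw [γ.target]
  have key : P.pathMonodromy (γ.map P.isCoveringMap.continuous)
      ⟨_, p_deckFun hE e₁ e₂ h e⟩ = ⟨φ.symm (P.p e'), by
        rw [← h1]; exact (hΓ 1).trans (congrArg P.p γ.target)⟩ := by
    refine P.pathMonodromy_eq _ Γ hΓ ?_ h1
    change φ.symm (P.p (γ 0)) = _
    rw [γ.source]
    exact (congrArg φ.symm hpe.symm).trans (φ.left_inv hφ)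
  exact ((deckFun_gpath hE e₁ e₂ h (.ofPath γ)).trans (congrArg Subtype.val key)).symm

/-- The deck transformations act transitively on the fibres of a universal covering. -/
lemma exists_deck [LocallyPathConnectedSpace M] (hE : P.IsUniversal) (e₁ e₂ : E)
    (h : P.p e₂ = P.p e₁) : ∃ f : P.Deck, f.toHomeomorph e₁ = e₂ :=
  ⟨{ toHomeomorph :=
      { toFun := deckFun hE e₁ e₂ h
        invFun := deckFun hE e₂ e₁ h.symm
        left_inv := deckFun_deckFun hE e₁ e₂ h
        right_inv := deckFun_deckFun hE e₂ e₁ h.symm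
        continuous_toFun := continuous_deckFun hE e₁ e₂ h
        continuous_invFun := continuous_deckFun hE e₂ e₁ h.symm }
     p_apply := p_deckFun hE e₁ e₂ h
     act_apply := deckFun_act hE e₁ e₂ h }, deckFun_self hE e₁ e₂ h⟩

end Deck

/-- `M` itself need not be connected, so every point is reached by monodromy along a `G`-path rather
than a path. -/
lemma surjective_p (P : Covering 𝒢 E) (hconn : 𝒢.IsConnected) (e₀ : E) :
    Function.Surjective P.p := fun x => by
  obtain ⟨κ⟩ := hconn (P.p e₀) x
  exact ⟨_, (P.monodromy κ ⟨e₀, rfl⟩).2⟩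

/-! ## Lifting simplices of the nerve -/

/-- The straight-line contraction of the simplex to `a₀` is read as a homotopy from a constant map
to `S`. The constant map lifts, hence so does the homotopy, and its end is a lift of `S`. -/
lemma exists_lift_simplex (hp : Function.Surjective P.p) {q : ℕ} (S : C(Delta q, M)) :
    ∃ F : C(Delta q, E), ∀ z, P.p (F z) = S z := by
  let H : C(unitInterval × Delta q, Delta q) :=
    { toFun := fun a => ⟨(1 - (a.1 : ℝ)) • (dvertex (q := q) 0).1 + (a.1 : ℝ) • a.2.1,
        convex_stdSimplex ℝ _ (dvertex (q := q) 0).2 a.2.2 (sub_nonneg.2 a.1.2.2) a.1.2.1 (by ring)⟩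
      continuous_toFun := by fun_prop }
  have hH0 : ∀ z, H (0, z) = dvertex 0 := fun z => by apply Subtype.ext; simp [H]
  have hH1 : ∀ z, H (1, z) = z := fun z => by apply Subtype.ext; simp [H]
  obtain ⟨e, he⟩ := hp (S (dvertex 0))
  have h0 : ∀ z, (S.comp H) (0, z) = P.p ((ContinuousMap.const (Delta q) e) z) := fun z => by
    rw [ContinuousMap.comp_apply, hH0, ContinuousMap.const_apply, he]
  refine ⟨(P.isCoveringMap.liftHomotopy (S.comp H) (.const _ e) h0).comp
    ⟨fun z => (1, z), by fun_prop⟩, fun z => ?_⟩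
  refine (congrFun (P.isCoveringMap.liftHomotopy_lifts (S.comp H) (.const _ e) h0) (1, z)).trans ?_
  rw [ContinuousMap.comp_apply, hH1]

/-- Every simplex of the nerve of `G` lifts to the nerve of `E ⋊ G`. -/
lemma exists_map_proj_eq (hp : Function.Surjective P.p) {q n : ℕ} (S : 𝒢.Simplex q n) :
    ∃ S' : P.actionGroupoid.Simplex q n, Simplex.map P.proj S' = S := by
  obtain ⟨F₀, hF₀⟩ := exists_lift_simplex (P := P) hp
    ⟨fun z => (S z).vertex 0, (Nerve.continuous_vertex 0).comp S.continuous⟩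
  have step : ∀ (j : Fin n) (F : C(Delta q, E)), (∀ z, P.p (F z) = (S z).vertex j.castSucc) →
      ∀ z, P.p (F z) = 𝒢.t ((S z).arrow j) := fun j F hF z => by rw [hF, (S z).t_arrow]
  -- Only the initial vertex uses the covering property. Each further vertex is forced, since the
  -- source of `(e, g)` is `e · g`.
  let V : ∀ j : Fin (n + 1), {F : C(Delta q, E) // ∀ z, P.p (F z) = (S z).vertex j} :=
    Fin.induction (motive := fun j => {F : C(Delta q, E) // ∀ z, P.p (F z) = (S z).vertex j})
      ⟨F₀, hF₀⟩ fun j F =>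
      ⟨⟨fun z => P.act (F.1 z) ((S z).arrow j) (step j F.1 F.2 z),
        P.continuous_act.comp (Continuous.subtype_mk (F.1.continuous.prodMk
          ((Nerve.continuous_arrow j).comp S.continuous)) (step j F.1 F.2))⟩,
        fun z => (P.p_act _ _ _).trans ((S z).s_arrow j)⟩
  have hV : ∀ (j : Fin n) z, (V j.succ).1 z =
      P.act ((V j.castSucc).1 z) ((S z).arrow j) (step j _ (V j.castSucc).2 z) := fun j z => by
    simp only [V, Fin.induction_succ]; rfl
  refine ⟨⟨fun z => ⟨(fun j => (V j).1 z, fun j => ⟨((V j.castSucc).1 z, (S z).arrow j),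
    step j _ (V j.castSucc).2 z⟩), fun j => ⟨rfl, (hV j z).symm⟩⟩, ?_⟩, ?_⟩
  · refine Continuous.subtype_mk ((continuous_pi fun j => (V j).1.continuous).prodMk
      (continuous_pi fun j => Continuous.subtype_mk ((V j.castSucc).1.continuous.prodMk
        ((Nerve.continuous_arrow j).comp S.continuous)) _)) _
  · ext1 z
    apply Subtype.ext
    exact Prod.ext (funext fun j => (V j).2 z) rfl

/-- A point of the nerve of `E ⋊ G` is determined by its initial vertex and its projection. -/
lemma nerve_ext {n : ℕ} {a b : P.actionGroupoid.Nerve n} (h0 : a.vertex 0 = b.vertex 0)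
    (h : Nerve.map P.proj n a = Nerve.map P.proj n b) : a = b := by
  have harr : ∀ j, (a.arrow j).1.2 = (b.arrow j).1.2 := fun j =>
    congrArg (fun c : 𝒢.Nerve n => c.arrow j) h
  have hv : ∀ j, a.vertex j = b.vertex j := by
    intro j
    induction j using Fin.induction with
    | zero => exact h0
    | succ j ih =>
      rw [← a.s_arrow, ← b.s_arrow]
      refine P.act_congr ?_ (harr j) _
      exact (a.t_arrow j).trans (ih.trans (b.t_arrow j).symm)
  apply Subtype.ext
  refine Prod.ext (funext hv) (funext fun j => Subtype.ext (Prod.ext ?_ (harr j)))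
  exact (a.t_arrow j).trans ((hv _).trans (b.t_arrow j).symm)

/-- Two lifts of a simplex differ by a deck transformation. -/
lemma exists_deck_map_eq [LocallyPathConnectedSpace M] (hE : P.IsUniversal) {q n : ℕ}
    {S S' : P.actionGroupoid.Simplex q n}
    (h : Simplex.map P.proj S = Simplex.map P.proj S') :
    ∃ f : P.Deck, Simplex.map f.hom S = S' := by
  have hz : ∀ z, Nerve.map P.proj n (S z) = Nerve.map P.proj n (S' z) := fun z =>
    DFunLike.congr_fun h z
  have hv : ∀ z, P.p ((S z).vertex 0) = P.p ((S' z).vertex 0) := fun z =>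
    congrArg (fun c : 𝒢.Nerve n => c.vertex 0) (hz z)
  obtain ⟨f, hf⟩ := exists_deck hE ((S (dvertex 0)).vertex 0) ((S' (dvertex 0)).vertex 0)
    (hv (dvertex 0)).symm
  have hproj : ∀ a : P.actionGroupoid.Nerve n,
      Nerve.map P.proj n (Nerve.map f.hom n a) = Nerve.map P.proj n a := fun a =>
    Subtype.ext (Prod.ext (funext fun j => f.p_apply _) rfl)
  refine ⟨f, ?_⟩
  -- The deck transformation was chosen to match the initial vertices at the single point `a₀`;
  -- uniqueness of lifts on the connected simplex extends this to all points.
  have hc : (fun z => f.toHomeomorph ((S z).vertex 0)) = fun z => (S' z).vertex 0 := by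
    refine P.isCoveringMap.eq_of_comp_eq
      (f.toHomeomorph.continuous.comp ((Nerve.continuous_vertex 0).comp S.continuous))
      ((Nerve.continuous_vertex 0).comp S'.continuous) ?_ (dvertex 0) hf
    exact funext fun z => (f.p_apply _).trans (hv z)
  ext1 z
  exact nerve_ext (congrFun hc z) ((hproj (S z)).trans (hz z))

end Covering

end TopGroupoid

/-! ## The simplicial identities -/

/-- The alternating sums of two families of face maps compose to zero. -/
lemma alternating_sum_comp {m : ℕ} {A B C : Type*} [AddCommGroup A] [AddCommGroup B]
    [AddCommGroup C] (f : Fin (m + 1) → A →ₗ[ℤ] B) (g : Fin m → B →ₗ[ℤ] C)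
    (h : ∀ i j : Fin m, i ≤ j → g i ∘ₗ f j.succ = g j ∘ₗ f i.castSucc) :
    (∑ i : Fin m, ((-1 : ℤ) ^ (i : ℕ)) • g i) ∘ₗ
      (∑ j : Fin (m + 1), ((-1 : ℤ) ^ (j : ℕ)) • f j) = 0 := by
  have expand : (∑ i : Fin m, ((-1 : ℤ) ^ (i : ℕ)) • g i) ∘ₗ
      (∑ j : Fin (m + 1), ((-1 : ℤ) ^ (j : ℕ)) • f j) =
      ∑ ij : Fin m × Fin (m + 1), ((-1 : ℤ) ^ ((ij.1 : ℕ) + (ij.2 : ℕ))) • (g ij.1 ∘ₗ f ij.2) := by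
    refine LinearMap.ext fun a => ?_
    simp only [LinearMap.comp_apply, LinearMap.sum_apply, LinearMap.smul_apply, map_sum, map_smul,
      Fintype.sum_prod_type, pow_add, mul_smul, Finset.smul_sum]
    rw [Finset.sum_comm]
    exact Finset.sum_congr rfl fun i _ => Finset.sum_congr rfl fun j _ => smul_comm _ _ _
  rw [expand]
  let S : Finset (Fin m × Fin (m + 1)) := {ij | (ij.2 : ℕ) ≤ (ij.1 : ℕ)}
  rw [← Finset.sum_add_sum_compl S, ← eq_neg_iff_add_eq_zero, ← Finset.sum_neg_distrib]
  -- The terms with `j ≤ i` cancel against those with `i < j` under `(i, j) ↦ (j, i + 1)`, which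
  -- changes the parity of the exponent.
  let φ : ∀ ij : Fin m × Fin (m + 1), ij ∈ S → Fin m × Fin (m + 1) := fun ij hij =>
    (Fin.castLT ij.2 (lt_of_le_of_lt (Finset.mem_filter.mp hij).right (Fin.is_lt ij.1)), ij.1.succ)
  apply Finset.sum_bij φ
  · intro ij hij
    simp_rw [S, φ, Finset.compl_filter, Finset.mem_filter_univ, Fin.val_succ,
      Fin.val_castLT] at hij ⊢
    omega
  · rintro ⟨i, j⟩ hij ⟨i', j'⟩ hij' h
    simp only [φ, Prod.mk.injEq, Fin.ext_iff, Fin.val_castLT, Fin.val_succ] at h ⊢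
    omega
  · rintro ⟨i', j'⟩ hij'
    simp_rw [S, Finset.compl_filter, Finset.mem_filter_univ, not_le] at hij'
    refine ⟨(j'.pred (by rintro rfl; simp at hij'), i'.castSucc), ?_, ?_⟩
    · simp only [S, Finset.mem_filter_univ, Fin.val_castSucc, Fin.val_pred]
      omega
    · simp only [φ, Fin.castLT_castSucc, Fin.succ_pred]
  · rintro ⟨i, j⟩ hij
    simp only [S, Finset.mem_filter_univ] at hij
    have hj : j = (Fin.castLT j (lt_of_le_of_lt hij i.is_lt)).castSucc := rfl
    simp only [φ]
    rw [h _ i (by rw [Fin.le_def]; exact hij), ← hj, ← neg_smul]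
    congr 1
    simp only [Fin.val_castLT, Fin.val_succ]
    ring

/-- Both sides are the increasing map that omits `i` and `j + 1`. It governs the vertices of the
nerve faces as well as the singular faces. -/
lemma succAbove_comm {m : ℕ} (i j : Fin (m + 2)) (h : i ≤ j) (k : Fin (m + 1)) :
    j.succ.succAbove (i.succAbove k) = i.castSucc.succAbove (j.succAbove k) := by
  rw [Fin.le_def] at h
  apply Fin.ext
  simp only [Fin.succAbove, Fin.lt_def]
  split_ifs <;> simp at * <;> omega

namespace TopGroupoid

variable {M : Type uM} {G : Type uG} [TopologicalSpace M] [TopologicalSpace G]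
  {𝒢 : TopGroupoid M G}

lemma mul_congr {g g' h h' : G} (hg : g = g') (hh : h = h') (hgh : 𝒢.s g = 𝒢.t h) :
    𝒢.mul g h hgh = 𝒢.mul g' h' (by rw [← hg, ← hh, hgh]) := by
  subst hg hh; rfl

namespace Nerve

lemma faceArrow_of_lt {n : ℕ} {k : Fin (n + 2)} {a : 𝒢.Nerve (n + 1)} {j : Fin n}
    (h : (j : ℕ) + 1 < k) : faceArrow k a j = a.arrow j.castSucc := if_pos h

lemma faceArrow_of_eq {n : ℕ} {k : Fin (n + 2)} {a : 𝒢.Nerve (n + 1)} {j : Fin n}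
    (h : (j : ℕ) + 1 = k) :
    faceArrow k a j = 𝒢.mul (a.arrow j.castSucc) (a.arrow j.succ) (a.composable j) := by
  unfold faceArrow
  rw [if_neg (by omega), if_pos h]

lemma faceArrow_of_gt {n : ℕ} {k : Fin (n + 2)} {a : 𝒢.Nerve (n + 1)} {j : Fin n}
    (h : k < (j : ℕ) + 1) : faceArrow k a j = a.arrow j.succ := by
  unfold faceArrow
  rw [if_neg (by omega), if_neg (by omega)]

lemma arrow_face {n : ℕ} (k : Fin (n + 2)) (a : 𝒢.Nerve (n + 1)) (j : Fin n) :
    (face k a).arrow j = faceArrow k a j := rfl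

/-- On arrows, the position `l + 1` is compared with `i` and `j`. Associativity is needed only for
`l + 1 = i = j`, where three consecutive arrows are composed; otherwise both sides are the same
arrow or the same product of two. -/
lemma face_face {n : ℕ} (i j : Fin (n + 2)) (h : i ≤ j) (a : 𝒢.Nerve (n + 2)) :
    face i (face j.succ a) = face j (face i.castSucc a) := by
  apply Subtype.ext
  refine Prod.ext (funext fun k => ?_) (funext fun l => ?_)
  · exact congrArg a.vertex (succAbove_comm i j h k)
  change faceArrow i (face j.succ a) l = faceArrow j (face i.castSucc a) l
  rw [Fin.le_def] at h
  rcases lt_trichotomy ((l : ℕ) + 1) i with h1 | h1 | h1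
  · rw [faceArrow_of_lt h1, faceArrow_of_lt (by omega), arrow_face, arrow_face,
      faceArrow_of_lt (by simp; omega), faceArrow_of_lt (by simpa using h1)]
  · rw [faceArrow_of_eq h1]
    rcases h.lt_or_eq with h2 | h2
    · rw [faceArrow_of_lt (by omega)]
      refine Eq.trans ?_ ((arrow_face _ _ _).trans (faceArrow_of_eq (by simpa using h1))).symm
      refine mul_congr ?_ ?_ _
      · rw [arrow_face, faceArrow_of_lt (by simp; omega)]
      · rw [arrow_face, faceArrow_of_lt (by simp; omega)]; rfl
    · rw [faceArrow_of_eq (by omega)]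
      refine (mul_congr (g' := a.arrow l.castSucc.castSucc)
        (h' := 𝒢.mul (a.arrow l.succ.castSucc) (a.arrow l.succ.succ) (a.composable l.succ))
        ?_ ?_ _).trans ((𝒢.mul_assoc _ _ _ (a.composable l.castSucc) (a.composable l.succ)).symm.trans
        (mul_congr ?_ ?_ _).symm)
      · rw [arrow_face, faceArrow_of_lt (by simp; omega)]
      · rw [arrow_face, faceArrow_of_eq (by simp; omega)]
      · rw [arrow_face, faceArrow_of_eq (by simpa using h1)]
      · rw [arrow_face, faceArrow_of_gt (by simp; omega)]
  · rw [faceArrow_of_gt h1]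
    rcases lt_trichotomy ((l : ℕ) + 1) j with h2 | h2 | h2
    · rw [faceArrow_of_lt h2, arrow_face, arrow_face, faceArrow_of_lt (by simp; omega),
        faceArrow_of_gt (by simpa using h1)]
      rfl
    · rw [faceArrow_of_eq h2, arrow_face, faceArrow_of_eq (by simp; omega)]
      refine mul_congr ?_ ?_ _
      · rw [arrow_face, faceArrow_of_gt (by simpa using h1)]; rfl
      · rw [arrow_face, faceArrow_of_gt (by simp; omega)]
    · rw [faceArrow_of_gt h2, arrow_face, arrow_face, faceArrow_of_gt (by simp; omega),
        faceArrow_of_gt (by simp; omega)]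

end Nerve

lemma dface_dface {q : ℕ} (i j : Fin (q + 2)) (h : i ≤ j) (z : Delta q) :
    dface j.succ (dface i z) = dface i.castSucc (dface j z) := by
  change stdSimplex.map j.succ.succAbove (stdSimplex.map i.succAbove z) =
    stdSimplex.map i.castSucc.succAbove (stdSimplex.map j.succAbove z)
  rw [stdSimplex.map_comp_apply, stdSimplex.map_comp_apply]
  congr 1
  exact funext (succAbove_comm i j h)

namespace IntChain

lemma del_del (q n : ℕ) : del 𝒢 q n ∘ₗ del 𝒢 q (n + 1) = 0 := by
  refine alternating_sum_comp _ _ fun i j h => ?_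
  rw [← Finsupp.lmapDomain_comp, ← Finsupp.lmapDomain_comp]
  congr 1
  funext S
  ext1 z
  exact Nerve.face_face i j h (S z)

lemma d_d (q n : ℕ) : d 𝒢 q n ∘ₗ d 𝒢 (q + 1) n = 0 := by
  refine alternating_sum_comp _ _ fun i j h => ?_
  rw [← Finsupp.lmapDomain_comp, ← Finsupp.lmapDomain_comp]
  congr 1
  funext S
  ext1 z
  exact congrArg S (dface_dface i j h z)

lemma d_comp_del (q n : ℕ) :
    d 𝒢 q n ∘ₗ del 𝒢 (q + 1) n = del 𝒢 q n ∘ₗ d 𝒢 q (n + 1) := by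
  refine LinearMap.ext fun c => ?_
  simp only [d, del, LinearMap.comp_apply, LinearMap.sum_apply, LinearMap.smul_apply, map_sum,
    map_smul, Finset.smul_sum, Finsupp.lmapDomain_apply, ← Finsupp.mapDomain_comp]
  rw [Finset.sum_comm]
  refine Finset.sum_congr rfl fun _ _ => Finset.sum_congr rfl fun _ _ => ?_
  rw [smul_comm]
  rfl

end IntChain

namespace Covering

variable {E : Type uE} [TopologicalSpace E] {P : Covering 𝒢 E} {R : Type uR} [Ring R]

/-- The identities already hold for integral chains, so they hold on classes of pure tensors. -/
lemma isDoubleComplex_equivariantDoubleComplex (hE : P.IsUniversal) (e₀ : E)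
    (L : LocalSystem.{uM, uG, uR, uL} R 𝒢) :
    (P.equivariantDoubleComplex hE e₀ L).IsDoubleComplex where
  del_del q n := by
    refine Submodule.linearMap_qext _ (TensorProduct.AlgebraTensorModule.ext fun v c => ?_)
    change Submodule.Quotient.mk (v ⊗ₜ[ℤ] ((IntChain.del _ q n ∘ₗ IntChain.del _ q (n + 1)) c)) = _
    rw [IntChain.del_del, LinearMap.zero_apply, TensorProduct.tmul_zero]
    rfl
  d_d q n := by
    refine Submodule.linearMap_qext _ (TensorProduct.AlgebraTensorModule.ext fun v c => ?_)
    change Submodule.Quotient.mk (v ⊗ₜ[ℤ] ((IntChain.d _ q n ∘ₗ IntChain.d _ (q + 1) n) c)) = _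
    rw [IntChain.d_d, LinearMap.zero_apply, TensorProduct.tmul_zero]
    rfl
  comm q n := by
    refine Submodule.linearMap_qext _ (TensorProduct.AlgebraTensorModule.ext fun v c => ?_)
    change Submodule.Quotient.mk (v ⊗ₜ[ℤ] ((IntChain.d _ q n ∘ₗ IntChain.del _ (q + 1) n) c)) = _
    rw [IntChain.d_comp_del]
    rfl

end Covering

end TopGroupoid

/-! ### Isomorphisms of double complexes and total homology -/

namespace DoubleComplexData

variable {R : Type uR} [Ring R] {A : DoubleComplexData.{uR, uL} R} {B : DoubleComplexData.{uR, uE} R}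

namespace Iso

/-- Being a double complex is transported along isomorphisms. -/
lemma isDoubleComplex (Φ : A.Iso B) (hA : A.IsDoubleComplex) : B.IsDoubleComplex where
  del_del q n := by
    refine LinearMap.ext fun b => ?_
    obtain ⟨a, rfl⟩ := (Φ.equiv _ _).surjective b
    have := LinearMap.congr_fun (hA.del_del q n) a
    rw [LinearMap.comp_apply, LinearMap.zero_apply] at this
    rw [LinearMap.comp_apply, ← Φ.del_comm, ← Φ.del_comm, this, map_zero, LinearMap.zero_apply]
  d_d q n := by
    refine LinearMap.ext fun b => ?_
    obtain ⟨a, rfl⟩ := (Φ.equiv _ _).surjective b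
    have := LinearMap.congr_fun (hA.d_d q n) a
    rw [LinearMap.comp_apply, LinearMap.zero_apply] at this
    rw [LinearMap.comp_apply, ← Φ.d_comm, ← Φ.d_comm, this, map_zero, LinearMap.zero_apply]
  comm q n := by
    refine LinearMap.ext fun b => ?_
    obtain ⟨a, rfl⟩ := (Φ.equiv _ _).surjective b
    have := LinearMap.congr_fun (hA.comm q n) a
    rw [LinearMap.comp_apply, LinearMap.comp_apply] at this
    rw [LinearMap.comp_apply, LinearMap.comp_apply, ← Φ.del_comm, ← Φ.d_comm, this, Φ.del_comm,
      Φ.d_comm]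

/-- The isomorphism of total complexes. -/
def tot (Φ : A.Iso B) (v : ℕ) : A.Tot v ≃ₗ[R] B.Tot v :=
  DFinsupp.mapRange.linearEquiv fun i => Φ.equiv i.1.1 i.1.2

lemma tot_incl (Φ : A.Iso B) {v : ℕ} (q n : ℕ) (h : q + n = v) (a : A.C q n) :
    Φ.tot v (A.incl q n h a) = B.incl q n h (Φ.equiv q n a) := by
  classical
  exact DFinsupp.mapRange_single (f := fun (i : {i : ℕ × ℕ // i.1 + i.2 = v}) =>
    Φ.equiv i.1.1 i.1.2) (hf := fun i => map_zero _)

lemma tot_delta (Φ : A.Iso B) (v : ℕ) (a : A.Tot (v + 1)) :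
    Φ.tot v (A.delta v a) = B.delta v (Φ.tot (v + 1) a) := by
  classical
  suffices h : (Φ.tot v).toLinearMap ∘ₗ A.delta v = B.delta v ∘ₗ (Φ.tot (v + 1)).toLinearMap from
    LinearMap.congr_fun h a
  refine DirectSum.linearMap_ext R fun i => LinearMap.ext fun a => ?_
  obtain ⟨⟨q, n⟩, hi⟩ := i
  have hlof : DirectSum.lof R {i : ℕ × ℕ // i.1 + i.2 = v + 1} (fun i => A.C i.1.1 i.1.2)
      ⟨(q, n), hi⟩ a = A.incl q n hi a := by
    unfold incl; congr!
  have hA : A.delta v (A.incl q n hi a) = A.totDel v q n hi a + A.totD v q n hi a := by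
    unfold delta incl
    rw [DirectSum.toModule_lof]; rfl
  have hB : ∀ b, B.delta v (B.incl q n hi b) = B.totDel v q n hi b + B.totD v q n hi b := by
    intro b
    unfold delta incl
    rw [DirectSum.toModule_lof]; rfl
  simp only [LinearMap.comp_apply, LinearEquiv.coe_coe]
  rw [hlof, hA, Φ.tot_incl, hB, map_add]
  congr 1
  -- For `n = 0`, and below for `q = 0`, the corresponding part of the total differential is zero by
  -- definition.
  · cases n with
    | zero => exact map_zero _
    | succ n =>
      simp only [totDel, LinearMap.smul_apply, LinearMap.comp_apply, map_zsmul, Φ.tot_incl,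
        Φ.del_comm]
  · cases q with
    | zero => exact map_zero _
    | succ q =>
      simp only [totD, LinearMap.smul_apply, LinearMap.comp_apply, map_zsmul, Φ.tot_incl,
        Φ.d_comm]

lemma mem_cycles_iff (Φ : A.Iso B) (v : ℕ) (a : A.Tot v) :
    Φ.tot v a ∈ B.cycles v ↔ a ∈ A.cycles v := by
  cases v with
  | zero => exact Iff.rfl
  | succ v =>
    change B.delta v (Φ.tot (v + 1) a) = 0 ↔ A.delta v a = 0
    rw [← Φ.tot_delta, LinearEquiv.map_eq_zero_iff]

lemma mem_boundaries_iff (Φ : A.Iso B) (v : ℕ) (a : A.Tot v) :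
    Φ.tot v a ∈ B.boundaries v ↔ a ∈ A.boundaries v := by
  constructor
  · rintro ⟨b, hb⟩
    obtain ⟨c, rfl⟩ := (Φ.tot (v + 1)).surjective b
    exact ⟨c, (Φ.tot v).injective ((Φ.tot_delta v c).trans hb)⟩
  · rintro ⟨c, rfl⟩
    exact ⟨Φ.tot (v + 1) c, (Φ.tot_delta v c).symm⟩

/-- The isomorphism of cycles. -/
def cycles (Φ : A.Iso B) (v : ℕ) : A.cycles v ≃ₗ[R] B.cycles v :=
  (Φ.tot v).ofSubmodules _ _ (by
    ext b
    obtain ⟨a, rfl⟩ := (Φ.tot v).surjective b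
    rw [Φ.mem_cycles_iff, Submodule.mem_map]
    exact ⟨fun ⟨a', ha', h⟩ => (Φ.tot v).injective h ▸ ha', fun h => ⟨a, h, rfl⟩⟩)

/-- Isomorphic double complexes have isomorphic total homology. -/
def totalHomology (Φ : A.Iso B) (v : ℕ) : A.TotalHomology v ≃ₗ[R] B.TotalHomology v :=
  Submodule.Quotient.equiv _ _ (Φ.cycles v) (by
    ext b
    obtain ⟨a, rfl⟩ := (Φ.cycles v).surjective b
    rw [Submodule.mem_map]
    refine Iff.trans ?_ (Φ.mem_boundaries_iff v a).symm
    exact ⟨fun ⟨a', ha', h⟩ => (Φ.cycles v).injective h ▸ ha', fun h => ⟨a, h, rfl⟩⟩)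

end Iso

end DoubleComplexData

/-! ### Local systems: base points that agree only propositionally -/

namespace TopGroupoid

variable {M : Type uM} {G : Type uG} [TopologicalSpace M] [TopologicalSpace G]
  {𝒢 : TopGroupoid M G} {R : Type uR} [Ring R]

namespace Hom

/-- Composition of groupoid morphisms: first `φ`, then `ψ`. -/
def comp {M' G' M'' G'' : Type*} [TopologicalSpace M'] [TopologicalSpace G']
    [TopologicalSpace M''] [TopologicalSpace G''] {𝒢' : TopGroupoid M' G'}
    {𝒢'' : TopGroupoid M'' G''} (φ : Hom 𝒢 𝒢') (ψ : Hom 𝒢' 𝒢'') : Hom 𝒢 𝒢'' where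
  obj x := ψ.obj (φ.obj x)
  arr g := ψ.arr (φ.arr g)
  continuous_obj := ψ.continuous_obj.comp φ.continuous_obj
  continuous_arr := ψ.continuous_arr.comp φ.continuous_arr
  s_arr g := by rw [ψ.s_arr, φ.s_arr]
  t_arr g := by rw [ψ.t_arr, φ.t_arr]
  arr_u x := by rw [φ.arr_u, ψ.arr_u]
  arr_mul g h hgh := by rw [φ.arr_mul, ψ.arr_mul]

end Hom

lemma GPath.map_map {M' G' M'' G'' : Type*} [TopologicalSpace M'] [TopologicalSpace G']
    [TopologicalSpace M''] [TopologicalSpace G''] {𝒢' : TopGroupoid M' G'}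
    {𝒢'' : TopGroupoid M'' G''} (φ : Hom 𝒢 𝒢') (ψ : Hom 𝒢' 𝒢'') {x y : M} (σ : GPath 𝒢 x y) :
    (σ.map φ).map ψ = σ.map (φ.comp ψ) := by
  induction σ with
  | ofPath σ => rfl
  | snoc τ g hs ht σ ih =>
    simp only [GPath.map, ih]
    rfl

namespace LocalSystem

variable (L : LocalSystem.{uM, uG, uR, uL} R 𝒢)

/-- Coefficients in fibres over propositionally equal points are compared by heterogeneous equality;
together with `elem_congr` this removes the casts from the boundary formulas. -/
lemma cast_heq {x y : M} (h : x = y) (v : L.fib x) : L.cast h v ≍ v := by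
  subst h; rfl

lemma elem_congr {q n : ℕ} {S S' : 𝒢.Simplex q n} (h : S = S') {v : L.fib (Simplex.base S)}
    {v' : L.fib (Simplex.base S')} (hv : v ≍ v') : L.elem S v = L.elem S' v' := by
  subst h
  rw [eq_of_heq hv]

lemma tr_castEnd {x y y' : M} (h : y = y') (σ : GPath 𝒢 x y) (v : L.fib y') :
    L.tr (GPath.castEnd h σ) v = L.tr σ (L.cast h.symm v) := by
  subst h; rfl

/-- Needed because a deck transformation followed by `p` equals `p` only propositionally, so one
path acquires two descriptions of its projected endpoints. -/
lemma tr_map_congr {M' G' : Type*} [TopologicalSpace M'] [TopologicalSpace G']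
    {𝒢' : TopGroupoid M' G'} {φ ψ : Hom 𝒢' 𝒢} (h : φ = ψ) {x y : M'} (σ : GPath 𝒢' x y)
    {v : L.fib (φ.obj y)} {w : L.fib (ψ.obj y)} (hv : v ≍ w) :
    L.tr (σ.map φ) v ≍ L.tr (σ.map ψ) w := by
  subst h
  rw [eq_of_heq hv]

/-- The transport backwards along an arrow, up to identifications of the endpoints. -/
lemma trEquiv_arrow_symm_heq {x y : M} (g : G) (hs : 𝒢.s g = x) (ht : 𝒢.t g = y)
    {v : L.fib (𝒢.s g)} {w : L.fib x} (hv : v ≍ w) :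
    (L.trEquiv (GPath.arrow g)).symm v ≍
      (L.trEquiv (GPath.snoc (GPath.const 𝒢 x) g hs ht (Path.refl y))).symm w := by
  subst hs ht
  rw [eq_of_heq hv]
  rfl

open Classical in
lemma del_elem {q n : ℕ} (S : 𝒢.Simplex q (n + 1)) (v : L.fib (Simplex.base S)) :
    L.del q n (L.elem S v) =
      (∑ k : Fin (n + 1), ((-1 : ℤ) ^ (k : ℕ)) • L.elem (S.nface k.castSucc)
        (L.cast (Simplex.base_nface_castSucc k S).symm v)) +
      ((-1 : ℤ) ^ (n + 1)) • L.elem (S.nface (Fin.last (n + 1)))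
        (L.cast (Simplex.base_nface_last S).symm ((L.trEquiv (GPath.arrow S.lastArrow)).symm
          (L.cast (Simplex.s_lastArrow S).symm v))) := by
  unfold del elem
  rw [DirectSum.toModule_lof]
  simp only [LinearMap.add_apply, LinearMap.sum_apply, LinearMap.smul_apply, LinearMap.comp_apply]
  rfl

open Classical in
lemma d_elem {q n : ℕ} (S : 𝒢.Simplex (q + 1) n) (v : L.fib (Simplex.base S)) :
    L.d q n (L.elem S v) =
      L.elem (S.sface 0) (L.cast (Simplex.base_sface_zero S).symm
        (L.tr (GPath.ofPath S.edge) v)) +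
      ∑ j : Fin (q + 1), ((-1 : ℤ) ^ ((j : ℕ) + 1)) • L.elem (S.sface j.succ)
        (L.cast (Simplex.base_sface_succ j S).symm v) := by
  unfold d elem
  rw [DirectSum.toModule_lof]
  simp only [LinearMap.add_apply, LinearMap.sum_apply, LinearMap.smul_apply, LinearMap.comp_apply]
  rfl

end LocalSystem

namespace Covering

variable {E : Type uE} [TopologicalSpace E] {P : Covering 𝒢 E}

/-! ## Transport along `E ⋊ G`-paths -/

lemma Deck.comp_proj (f : P.Deck) : f.hom.comp P.proj = P.proj := by
  have : (f.hom.comp P.proj).obj = P.proj.obj := funext f.p_apply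
  cases h : f.hom.comp P.proj
  cases h' : P.proj
  simp only [Hom.mk.injEq]
  refine ⟨?_, ?_⟩
  · have h1 := congrArg Hom.obj h
    have h2 := congrArg Hom.obj h'
    exact h1.symm.trans (this.trans h2)
  · have h1 := congrArg Hom.arr h
    have h2 := congrArg Hom.arr h'
    exact h1.symm.trans h2

/-- The projection of an `E ⋊ G`-path to a `G`-path. -/
def projPath {e e' : E} (ρ : GPath P.actionGroupoid e e') : GPath 𝒢 (P.p e) (P.p e') :=
  ρ.map P.proj

lemma projPath_concat {e e' e'' : E} (ρ : GPath P.actionGroupoid e e')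
    (ρ' : GPath P.actionGroupoid e' e'') :
    projPath (ρ.concat ρ') = (projPath ρ).concat (projPath ρ') :=
  GPath.map_concat P.proj ρ ρ'

section Transport

variable (hE : P.IsUniversal) (e₀ : E) (L : LocalSystem.{uM, uG, uR, uL} R 𝒢)

/-- The isomorphism `𝓛_{p e} ≅ 𝓛_{p e₀}` along the projection of any `E ⋊ G`-path from `e₀` to
`e`. -/
def transport (e : E) : L.fib (P.p e) ≃ₗ[R] L.fib (P.p e₀) :=
  L.trEquiv (projPath (hE.1 e₀ e).some)

/-- Closing both paths by the same `τ` gives homotopic loops, and transport along `τ` cancels since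
it is bijective. -/
lemma tr_projPath_eq (hE : P.IsUniversal) {e e' : E} (ρ ρ' : GPath P.actionGroupoid e e') :
    L.tr (projPath ρ) = L.tr (projPath ρ') := by
  obtain ⟨τ⟩ := hE.1 e' e
  have : L.tr (projPath (ρ.concat τ)) = L.tr (projPath (ρ'.concat τ)) :=
    L.tr_homotopic _ _ ((hE.homotopic_loop (ρ.concat τ) (ρ'.concat τ)).map P.proj)
  rw [projPath_concat, projPath_concat, L.tr_concat, L.tr_concat] at this
  refine LinearMap.ext fun v => ?_
  obtain ⟨w, rfl⟩ := (L.tr_bijective (projPath τ)).2 v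
  exact LinearMap.congr_fun this w

lemma transport_apply {e : E} (ρ : GPath P.actionGroupoid e₀ e) (v : L.fib (P.p e)) :
    transport hE e₀ L e v = L.tr (projPath ρ) v :=
  LinearMap.congr_fun (tr_projPath_eq L hE _ ρ) v

/-- The transports trivialise the pullback of `𝓛` to `E`. The twists in both boundary operators are
derived from this. -/
lemma transport_tr {e e' : E} (ρ : GPath P.actionGroupoid e e') (v : L.fib (P.p e')) :
    transport hE e₀ L e (L.tr (projPath ρ) v) = transport hE e₀ L e' v := by
  obtain ⟨τ⟩ := hE.1 e₀ e
  rw [transport_apply hE e₀ L τ, transport_apply hE e₀ L (τ.concat ρ), projPath_concat,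
    L.tr_concat]
  rfl

lemma tr_transport_symm {e e' : E} (ρ : GPath P.actionGroupoid e e') (v : L.fib (P.p e₀)) :
    L.tr (projPath ρ) ((transport hE e₀ L e').symm v) = (transport hE e₀ L e).symm v := by
  rw [LinearEquiv.eq_symm_apply, transport_tr, LinearEquiv.apply_symm_apply]

lemma trEquiv_symm_transport_symm {e e' : E} (ρ : GPath P.actionGroupoid e e')
    (v : L.fib (P.p e₀)) :
    (L.trEquiv (projPath ρ)).symm ((transport hE e₀ L e).symm v) =
      (transport hE e₀ L e').symm v := by
  rw [LinearEquiv.symm_apply_eq]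
  exact (tr_transport_symm hE e₀ L ρ v).symm

lemma transport_symm_heq {e e' : E} (h : e = e') (v : L.fib (P.p e₀)) :
    (transport hE e₀ L e).symm v ≍ (transport hE e₀ L e').symm v := by
  subst h; rfl

/-- The action of a deck transformation `f` on `𝓛₀` in terms of the transports to `e` and `f e`. -/
lemma fibAct_transport (f : P.Deck) (e : E) {v : L.fib (P.p e)}
    {w : L.fib (P.p (f.toHomeomorph e))} (hv : v ≍ w) :
    f.fibAct hE e₀ L (transport hE e₀ L (f.toHomeomorph e) w) = transport hE e₀ L e v := by
  obtain ⟨σ⟩ := hE.1 e₀ (f.toHomeomorph e₀)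
  obtain ⟨ρ⟩ := hE.1 e₀ e
  -- The endpoint `f e` is reached by `σ` followed by the image `ρ'` of `ρ` under `f`. As `ρ'` and
  -- `ρ` have the same projection, the transport from `f e` is that from `e` followed by `σ_#`,
  -- which the action of `f` inverts.
  obtain ⟨ρ', h⟩ : ∃ ρ' : GPath P.actionGroupoid (f.toHomeomorph e₀) (f.toHomeomorph e),
      projPath ρ' = ρ.map (f.hom.comp P.proj) := ⟨ρ.map f.hom, GPath.map_map _ _ ρ⟩
  rw [f.fibAct_eq hE e₀ L σ, LinearEquiv.symm_apply_eq]
  change _ = L.tr (GPath.castEnd (f.p_apply e₀) (projPath σ)) _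
  rw [L.tr_castEnd, transport_apply hE e₀ L (σ.concat ρ'), projPath_concat, L.tr_concat,
    transport_apply hE e₀ L ρ]
  refine congrArg (L.tr (projPath σ)) (eq_of_heq ?_)
  rw [h]
  exact (L.tr_map_congr f.comp_proj ρ hv.symm).trans (L.cast_heq _ _).symm

end Transport

/-! ## The Eilenberg isomorphism -/

section Eilenberg

variable (hE : P.IsUniversal) (e₀ : E) (L : LocalSystem.{uM, uG, uR, uL} R 𝒢)

/-- Maps out of `𝓛₀ ⊗ C_q(E⁽ⁿ⁾, ℤ)` agree if they agree on all `v ⊗ Σ`. -/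
lemma tensorChain_hom_ext {q n : ℕ} {N : Type*} [AddCommGroup N] [Module R N]
    {f g : P.TensorChain e₀ L q n →ₗ[R] N}
    (h : ∀ v S, f (v ⊗ₜ[ℤ] Finsupp.single S 1) = g (v ⊗ₜ[ℤ] Finsupp.single S 1)) : f = g := by
  classical
  have key : f ∘ₗ (TensorProduct.finsuppScalarRight ℤ R (L.fib (P.p e₀))
      (P.actionGroupoid.Simplex q n)).symm.toLinearMap =
      g ∘ₗ (TensorProduct.finsuppScalarRight ℤ R (L.fib (P.p e₀))
      (P.actionGroupoid.Simplex q n)).symm.toLinearMap := by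
    refine Finsupp.lhom_ext fun S v => ?_
    simpa only [LinearMap.comp_apply, LinearEquiv.coe_coe,
      TensorProduct.finsuppScalarRight_symm_apply_single] using h v S
  refine LinearMap.ext fun t => ?_
  simpa using LinearMap.congr_fun key (TensorProduct.finsuppScalarRight ℤ R (L.fib (P.p e₀))
      (P.actionGroupoid.Simplex q n) t)

open Classical in
/-- The map `𝓛₀ ⊗ C_q(E⁽ⁿ⁾, ℤ) → C_q(G⁽ⁿ⁾, 𝓛)` sending `v ⊗ Σ` to `w · (p ∘ Σ)`, where `w` is the
image of `v` in the fibre over the base point of `p ∘ Σ`. -/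
def chainMap (q n : ℕ) : P.TensorChain e₀ L q n →ₗ[R] L.Chain q n :=
  (Finsupp.lsum ℕ fun S : P.actionGroupoid.Simplex q n =>
    L.elem (Simplex.map P.proj S) ∘ₗ
      ((transport hE e₀ L S.base).symm.toLinearMap :
        L.fib (P.p e₀) →ₗ[R] L.fib (Simplex.map P.proj S).base)) ∘ₗ
    (TensorProduct.finsuppScalarRight ℤ R (L.fib (P.p e₀))
      (P.actionGroupoid.Simplex q n)).toLinearMap

/-- The value `w · (p ∘ Σ)` of `chainMap` on `v ⊗ Σ`. -/
def chainElem {q n : ℕ} (v : L.fib (P.p e₀)) (S : P.actionGroupoid.Simplex q n) : L.Chain q n :=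
  L.elem (Simplex.map P.proj S) ((transport hE e₀ L S.base).symm v)

lemma chainMap_tmul {q n : ℕ} (v : L.fib (P.p e₀)) (S : P.actionGroupoid.Simplex q n) :
    chainMap hE e₀ L q n (v ⊗ₜ[ℤ] Finsupp.single S 1) = chainElem hE e₀ L v S := by
  classical
  rw [← TensorProduct.finsuppScalarRight_symm_apply_single (R := ℤ) (S := R)]
  unfold chainMap
  rw [LinearMap.comp_apply, LinearEquiv.coe_coe, LinearEquiv.apply_symm_apply, Finsupp.lsum_single]
  rfl

lemma Deck.map_proj_map (f : P.Deck) {q n : ℕ} (S : P.actionGroupoid.Simplex q n) :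
    Simplex.map P.proj (Simplex.map f.hom S) = Simplex.map P.proj S := by
  ext1 z
  exact Subtype.ext (Prod.ext (funext fun j => f.p_apply _) rfl)

/-- Both sides sit on the same simplex because `f` covers the identity of `M`; the coefficients
agree by `fibAct_transport`. -/
lemma chainElem_fibAct {q n : ℕ} (f : P.Deck) (v : L.fib (P.p e₀))
    (S : P.actionGroupoid.Simplex q n) :
    chainElem hE e₀ L (f.fibAct hE e₀ L v) S = chainElem hE e₀ L v (Simplex.map f.hom S) := by
  refine L.elem_congr (f.map_proj_map S).symm ?_
  have h := fibAct_transport hE e₀ L f S.base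
    (w := (transport hE e₀ L (f.toHomeomorph S.base)).symm v) (L.cast_heq (f.p_apply S.base) _)
  rw [LinearEquiv.apply_symm_apply] at h
  rw [h, LinearEquiv.symm_apply_apply]
  exact L.cast_heq _ _

lemma Q_le_ker_chainMap (q n : ℕ) :
    P.Q hE e₀ L q n ≤ LinearMap.ker (chainMap hE e₀ L q n) := by
  refine Submodule.span_le.2 ?_
  rintro _ ⟨v, f, c, rfl⟩
  rw [SetLike.mem_coe, LinearMap.mem_ker, map_sub, sub_eq_zero]
  -- Generators of `Q` involve arbitrary chains, but the relation is additive in `c`, which reduces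
  -- it to a single simplex.
  induction c using Finsupp.induction_linear with
  | zero => simp only [map_zero, TensorProduct.tmul_zero]
  | add c c' h h' => simp only [map_add, TensorProduct.tmul_add, h, h']
  | single S k =>
    have hk : Finsupp.single S k = k • Finsupp.single S (1 : ℤ) := by simp
    have hf : IntChain.map f.hom q n (Finsupp.single S 1) =
        Finsupp.single (Simplex.map f.hom S) 1 := by
      simp only [IntChain.map, Finsupp.lmapDomain_apply, Finsupp.mapDomain_single]
    rw [hk, map_smul, hf, TensorProduct.tmul_smul, TensorProduct.tmul_smul, map_zsmul, map_zsmul,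
      chainMap_tmul, chainMap_tmul, chainElem_fibAct]

/-- The map `𝓛₀ ⊗_{Γ^G(E)} C_q(E⁽ⁿ⁾, ℤ) → C_q(G⁽ⁿ⁾, 𝓛)` induced by `chainMap`. -/
def eilenbergMap (q n : ℕ) :
    (P.TensorChain e₀ L q n ⧸ P.Q hE e₀ L q n) →ₗ[R] L.Chain q n :=
  (P.Q hE e₀ L q n).liftQ (chainMap hE e₀ L q n) (Q_le_ker_chainMap hE e₀ L q n)

open Classical in
/-- The class of `v ⊗ Σ`, as a linear function of `v`. -/
def tensorClass {q n : ℕ} (S : P.actionGroupoid.Simplex q n) :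
    L.fib (P.p e₀) →ₗ[R] P.TensorChain e₀ L q n ⧸ P.Q hE e₀ L q n :=
  (P.Q hE e₀ L q n).mkQ ∘ₗ
    (TensorProduct.finsuppScalarRight ℤ R (L.fib (P.p e₀))
      (P.actionGroupoid.Simplex q n)).symm.toLinearMap ∘ₗ Finsupp.lsingle S

lemma tensorClass_apply {q n : ℕ} (S : P.actionGroupoid.Simplex q n) (v : L.fib (P.p e₀)) :
    tensorClass hE e₀ L S v = (P.Q hE e₀ L q n).mkQ (v ⊗ₜ[ℤ] Finsupp.single S 1) := by
  classical
  simp only [tensorClass, LinearMap.comp_apply, LinearEquiv.coe_coe, Finsupp.lsingle_apply,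
    TensorProduct.finsuppScalarRight_symm_apply_single]

lemma eilenbergMap_tensorClass {q n : ℕ} (S : P.actionGroupoid.Simplex q n)
    (v : L.fib (P.p e₀)) :
    eilenbergMap hE e₀ L q n (tensorClass hE e₀ L S v) = chainElem hE e₀ L v S := by
  rw [tensorClass_apply, ← chainMap_tmul]
  rfl

lemma tensorClass_fibAct {q n : ℕ} (f : P.Deck) (S : P.actionGroupoid.Simplex q n)
    (v : L.fib (P.p e₀)) :
    tensorClass hE e₀ L S (f.fibAct hE e₀ L v) = tensorClass hE e₀ L (Simplex.map f.hom S) v := by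
  rw [tensorClass_apply, tensorClass_apply, ← sub_eq_zero, ← map_sub]
  refine (Submodule.Quotient.mk_eq_zero _).2 (Submodule.subset_span ⟨v, f, Finsupp.single S 1, ?_⟩)
  simp only [IntChain.map, Finsupp.lmapDomain_apply, Finsupp.mapDomain_single]

lemma tensorClass_hom_ext {q n : ℕ} {N : Type*} [AddCommGroup N] [Module R N]
    {f g : (P.TensorChain e₀ L q n ⧸ P.Q hE e₀ L q n) →ₗ[R] N}
    (h : ∀ v S, f (tensorClass hE e₀ L S v) = g (tensorClass hE e₀ L S v)) : f = g := by
  refine Submodule.linearMap_qext _ (tensorChain_hom_ext e₀ L fun v S => ?_)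
  have := h v S
  rwa [tensorClass_apply] at this

/-- A class `v ⊗ Σ` is determined by the projection of `Σ` and the transported value of `v`. -/
lemma tensorClass_eq [LocallyPathConnectedSpace M] {q n : ℕ}
    {S S' : P.actionGroupoid.Simplex q n} (h : Simplex.map P.proj S = Simplex.map P.proj S')
    {v : L.fib (P.p S.base)} {v' : L.fib (P.p S'.base)} (hv : v ≍ v') :
    tensorClass hE e₀ L S (transport hE e₀ L S.base v) =
      tensorClass hE e₀ L S' (transport hE e₀ L S'.base v') := by
  -- Injectivity rests on this: the two lifts differ by a deck transformation, which the tensor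
  -- relation moves to the coefficient.
  obtain ⟨f, rfl⟩ := exists_deck_map_eq hE h
  rw [← tensorClass_fibAct]
  exact congrArg _ (fibAct_transport hE e₀ L f S.base hv).symm

section Inverse

variable (hp : Function.Surjective P.p)

/-- A lift of a simplex of the nerve of `G` to the nerve of `E ⋊ G`. -/
def liftSimplex {q n : ℕ} (S : 𝒢.Simplex q n) : P.actionGroupoid.Simplex q n :=
  (exists_map_proj_eq hp S).choose

lemma map_proj_liftSimplex {q n : ℕ} (S : 𝒢.Simplex q n) :
    Simplex.map P.proj (liftSimplex hp S) = S :=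
  (exists_map_proj_eq hp S).choose_spec

lemma p_base_liftSimplex {q n : ℕ} (S : 𝒢.Simplex q n) :
    P.p (liftSimplex hp S).base = S.base :=
  congrArg Simplex.base (map_proj_liftSimplex hp S)

open Classical in
/-- The inverse of `eilenbergMap`, defined by lifting simplices. -/
def eilenbergInv (q n : ℕ) :
    L.Chain q n →ₗ[R] P.TensorChain e₀ L q n ⧸ P.Q hE e₀ L q n :=
  DirectSum.toModule R _ _ fun S =>
    tensorClass hE e₀ L (liftSimplex hp S) ∘ₗ
      (transport hE e₀ L (liftSimplex hp S).base).toLinearMap ∘ₗ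
      (L.cast (p_base_liftSimplex hp S).symm).toLinearMap

open Classical in
lemma eilenbergInv_elem {q n : ℕ} (S : 𝒢.Simplex q n) (v : L.fib S.base) :
    eilenbergInv hE e₀ L hp q n (L.elem S v) = tensorClass hE e₀ L (liftSimplex hp S)
      (transport hE e₀ L (liftSimplex hp S).base
        (L.cast (p_base_liftSimplex hp S).symm v)) := by
  unfold eilenbergInv LocalSystem.elem
  rw [DirectSum.toModule_lof]
  rfl

open Classical in
/-- The isomorphism `𝓛₀ ⊗_{Γ^G(E)} C_q(E⁽ⁿ⁾, ℤ) ≅ C_q(G⁽ⁿ⁾, 𝓛)`. -/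
def eilenbergEquiv [LocallyPathConnectedSpace M] (q n : ℕ) :
    (P.TensorChain e₀ L q n ⧸ P.Q hE e₀ L q n) ≃ₗ[R] L.Chain q n :=
  LinearEquiv.ofLinearMap (eilenbergMap hE e₀ L q n) (eilenbergInv hE e₀ L hp q n)
    (by
      refine DirectSum.linearMap_ext R fun S => LinearMap.ext fun v => ?_
      change eilenbergMap hE e₀ L q n (eilenbergInv hE e₀ L hp q n (L.elem S v)) = L.elem S v
      rw [eilenbergInv_elem, eilenbergMap_tensorClass, chainElem, LinearEquiv.symm_apply_apply]
      exact L.elem_congr (map_proj_liftSimplex hp S) (L.cast_heq _ _))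
    (by
      refine tensorClass_hom_ext hE e₀ L fun v S => ?_
      rw [LinearMap.comp_apply, eilenbergMap_tensorClass, LinearMap.id_apply]
      -- The chosen lift of the projection of `S` need not be `S` itself, but it defines the same
      -- class.
      refine (eilenbergInv_elem hE e₀ L hp _ _).trans ?_
      refine (tensorClass_eq hE e₀ L (map_proj_liftSimplex hp _) (L.cast_heq _ _)).trans ?_
      rw [LinearEquiv.apply_symm_apply])

end Inverse

/-! ## Compatibility with the boundary operators -/

/-- Only the last nerve face omits the last vertex, so here the base point and the coefficient stay
the same. -/
lemma chainElem_nface_castSucc {q n : ℕ} (k : Fin (n + 1)) (v : L.fib (P.p e₀))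
    (S : P.actionGroupoid.Simplex q (n + 1)) :
    chainElem hE e₀ L v (S.nface k.castSucc) =
      L.elem ((Simplex.map P.proj S).nface k.castSucc)
        (L.cast (Simplex.base_nface_castSucc k (Simplex.map P.proj S)).symm
          ((transport hE e₀ L S.base).symm v)) := by
  refine L.elem_congr ?_ ?_
  · ext1 z
    exact Nerve.map_face P.proj _ (S z)
  · exact (transport_symm_heq hE e₀ L (Simplex.base_nface_castSucc k S) v).trans
      (L.cast_heq _ _).symm

/-- The last arrow `a` of `Σ(a₀)` is an `E ⋊ G`-path from the old base point to the new one, so the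
coefficient changes by the inverse transport along its projection `gₙ`. -/
lemma chainElem_nface_last {q n : ℕ} (v : L.fib (P.p e₀))
    (S : P.actionGroupoid.Simplex q (n + 1)) :
    chainElem hE e₀ L v (S.nface (Fin.last (n + 1))) =
      L.elem ((Simplex.map P.proj S).nface (Fin.last (n + 1)))
        (L.cast (Simplex.base_nface_last (Simplex.map P.proj S)).symm
          ((L.trEquiv (GPath.arrow (Simplex.map P.proj S).lastArrow)).symm
            (L.cast (Simplex.s_lastArrow (Simplex.map P.proj S)).symm
              ((transport hE e₀ L S.base).symm v)))) := by
  refine L.elem_congr ?_ ?_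
  · ext1 z
    exact Nerve.map_face P.proj _ (S z)
  let a : P.Arrow := S.lastArrow
  refine HEq.trans ?_ (L.cast_heq _ _).symm
  refine (transport_symm_heq hE e₀ L (Simplex.base_nface_last S) v).trans ?_
  rw [← trEquiv_symm_transport_symm hE e₀ L (GPath.arrow (𝒢 := P.actionGroupoid) a) v]
  refine (L.trEquiv_arrow_symm_heq a.1.2 (P.p_act _ _ _).symm a.2.symm ?_).symm
  exact (L.cast_heq _ _).trans (transport_symm_heq hE e₀ L (Simplex.s_lastArrow S).symm v)

/-- The edge of `Σ` in `E` runs from the new base point, over `a₁`, to the old one, so the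
coefficient is transported by `σ_#` itself, without inversion. -/
lemma chainElem_sface_zero {q n : ℕ} (v : L.fib (P.p e₀))
    (S : P.actionGroupoid.Simplex (q + 1) n) :
    chainElem hE e₀ L v (S.sface 0) =
      L.elem ((Simplex.map P.proj S).sface 0)
        (L.cast (Simplex.base_sface_zero (Simplex.map P.proj S)).symm
          (L.tr (GPath.ofPath (Simplex.map P.proj S).edge)
            ((transport hE e₀ L S.base).symm v))) := by
  refine L.elem_congr rfl ?_
  refine HEq.trans ?_ (L.cast_heq _ _).symm
  refine (transport_symm_heq hE e₀ L (Simplex.base_sface_zero S) v).trans ?_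
  rw [← tr_transport_symm hE e₀ L (GPath.ofPath S.edge) v]
  rfl

lemma chainElem_sface_succ {q n : ℕ} (j : Fin (q + 1)) (v : L.fib (P.p e₀))
    (S : P.actionGroupoid.Simplex (q + 1) n) :
    chainElem hE e₀ L v (S.sface j.succ) =
      L.elem ((Simplex.map P.proj S).sface j.succ)
        (L.cast (Simplex.base_sface_succ j (Simplex.map P.proj S)).symm
          ((transport hE e₀ L S.base).symm v)) :=
  L.elem_congr rfl ((transport_symm_heq hE e₀ L (Simplex.base_sface_succ j S) v).trans
    (L.cast_heq _ _).symm)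

lemma eilenbergMap_del (q n : ℕ)
    (x : P.TensorChain e₀ L q (n + 1) ⧸ P.Q hE e₀ L q (n + 1)) :
    eilenbergMap hE e₀ L q n ((P.equivariantDoubleComplex hE e₀ L).del q n x) =
      L.del q n (eilenbergMap hE e₀ L q (n + 1) x) := by
  suffices h : eilenbergMap hE e₀ L q n ∘ₗ (P.equivariantDoubleComplex hE e₀ L).del q n =
      L.del q n ∘ₗ eilenbergMap hE e₀ L q (n + 1) from LinearMap.congr_fun h x
  refine tensorClass_hom_ext hE e₀ L fun v S => ?_
  have h : (P.equivariantDoubleComplex hE e₀ L).del q n (tensorClass hE e₀ L S v) =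
      ∑ k : Fin (n + 2), ((-1 : ℤ) ^ (k : ℕ)) • tensorClass hE e₀ L (S.nface k) v := by
    rw [tensorClass_apply]
    change (P.Q hE e₀ L q n).mkQ (v ⊗ₜ[ℤ] IntChain.del P.actionGroupoid q n (.single S 1)) = _
    simp only [IntChain.del, LinearMap.sum_apply, LinearMap.smul_apply, Finsupp.lmapDomain_apply,
      Finsupp.mapDomain_single, TensorProduct.tmul_sum, TensorProduct.tmul_smul, map_sum,
      map_zsmul, tensorClass_apply]
  refine (congrArg (eilenbergMap hE e₀ L q n) h).trans ?_
  -- The last summand is split off because it alone is twisted; for `d` it is the summand with index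
  -- zero.
  rw [LinearMap.comp_apply, map_sum, Fin.sum_univ_castSucc]
  simp only [map_zsmul, eilenbergMap_tensorClass]
  refine Eq.trans ?_ (L.del_elem (Simplex.map P.proj S) _).symm
  rw [chainElem_nface_last]
  simp only [chainElem_nface_castSucc, Fin.val_castSucc, Fin.val_last]

lemma eilenbergMap_d (q n : ℕ)
    (x : P.TensorChain e₀ L (q + 1) n ⧸ P.Q hE e₀ L (q + 1) n) :
    eilenbergMap hE e₀ L q n ((P.equivariantDoubleComplex hE e₀ L).d q n x) =
      L.d q n (eilenbergMap hE e₀ L (q + 1) n x) := by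
  suffices h : eilenbergMap hE e₀ L q n ∘ₗ (P.equivariantDoubleComplex hE e₀ L).d q n =
      L.d q n ∘ₗ eilenbergMap hE e₀ L (q + 1) n from LinearMap.congr_fun h x
  refine tensorClass_hom_ext hE e₀ L fun v S => ?_
  have h : (P.equivariantDoubleComplex hE e₀ L).d q n (tensorClass hE e₀ L S v) =
      ∑ j : Fin (q + 2), ((-1 : ℤ) ^ (j : ℕ)) • tensorClass hE e₀ L (S.sface j) v := by
    rw [tensorClass_apply]
    change (P.Q hE e₀ L q n).mkQ (v ⊗ₜ[ℤ] IntChain.d P.actionGroupoid q n (.single S 1)) = _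
    simp only [IntChain.d, LinearMap.sum_apply, LinearMap.smul_apply, Finsupp.lmapDomain_apply,
      Finsupp.mapDomain_single, TensorProduct.tmul_sum, TensorProduct.tmul_smul, map_sum,
      map_zsmul, tensorClass_apply]
  refine (congrArg (eilenbergMap hE e₀ L q n) h).trans ?_
  rw [LinearMap.comp_apply, map_sum, Fin.sum_univ_succ]
  simp only [map_zsmul, eilenbergMap_tensorClass]
  refine Eq.trans ?_ (L.d_elem (Simplex.map P.proj S) _).symm
  rw [chainElem_sface_zero]
  simp only [chainElem_sface_succ, Fin.val_succ, Fin.val_zero, pow_zero, one_smul]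

/-- The Eilenberg isomorphism of double complexes. -/
def eilenbergIso [LocallyPathConnectedSpace M] (hp : Function.Surjective P.p) :
    (P.equivariantDoubleComplex hE e₀ L).Iso L.doubleComplex where
  equiv q n := eilenbergEquiv hE e₀ L hp q n
  del_comm q n x := eilenbergMap_del hE e₀ L q n x
  d_comm q n x := eilenbergMap_d hE e₀ L q n x

end Eilenberg

end Covering

end TopGroupoid


end

theorem mainTheorem4 {m k : ℕ} {M : Type uM} {G : Type uG} {E : Type uE}
    [TopologicalSpace M] [ChartedSpace (EuclideanSpace ℝ (Fin m)) M] [IsManifold (𝓡 m) ∞ M]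
    [TopologicalSpace G] [ChartedSpace (EuclideanSpace ℝ (Fin k)) G] [IsManifold (𝓡 k) ∞ G]
    [TopologicalSpace E]
    (𝒢 : TopGroupoid M G) (hLie : 𝒢.IsLie m k) (hconn : 𝒢.IsConnected)
    (P : 𝒢.Covering E) (hE : P.IsUniversal) (e₀ : E)
    {R : Type uR} [Ring R] (L : TopGroupoid.LocalSystem.{uM, uG, uR, uL} R 𝒢) :
    (P.equivariantDoubleComplex hE e₀ L).IsDoubleComplex ∧
    L.doubleComplex.IsDoubleComplex ∧
    Nonempty ((P.equivariantDoubleComplex hE e₀ L).Iso L.doubleComplex) ∧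
    ∀ v : ℕ, Nonempty ((P.equivariantDoubleComplex hE e₀ L).TotalHomology v ≃ₗ[R]
      L.doubleComplex.TotalHomology v) := by
  have : LocallyPathConnectedSpace M :=
    ChartedSpace.locallyPathConnectedSpace (EuclideanSpace ℝ (Fin m)) M
  have hA := TopGroupoid.Covering.isDoubleComplex_equivariantDoubleComplex hE e₀ L
  let Φ := TopGroupoid.Covering.eilenbergIso hE e₀ L (P.surjective_p hconn e₀)
  -- The identities for the twisted operators are not computed directly: they are inherited from the
  -- equivariant complex through `Φ`.
  exact ⟨hA, Φ.isDoubleComplex hA, ⟨Φ⟩, fun v => ⟨Φ.totalHomology v⟩⟩
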